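/- Let $K\subset\mathbb{R}^2$ be a compact convex set with at least two points. Let $r=r(K)$ be its inradius (the radius of a largest closed disc contained in $K$, a single point being a disc of radius $0$), $R=R(K)$ its circumradius (the radius of the smallest closed disc containing $K$), $D=D(K)$ its diameter, and $w=w(K)=\min_{\|u\|=1}\bigl(\max_{x\in K}\langle u,x\rangle-\min_{x\in K}\langle u,x\rangle\bigr)$ its minimal width. Then \[ w \;\le\; 2r\left(1+\frac{2rR}{D^2}\left(1+\sqrt{1-\left(\frac{D}{2R}\right)^2}\right)\right). \] Moreover, if $K$ is a nondegenerate triangle none of whose angles exceeds $\pi/2$, then all three vertices of $K$ lie on the boundary of the smallest closed disc containing $K$, and equality holds. -/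

import Mathlib

noncomputable section

namespace PlanarRadii

/-- The euclidean plane. -/
abbrev Plane : Type := EuclideanSpace ℝ (Fin 2)

/-- The breadth of `K` in direction `u`. For a unit vector `u` and a nonempty compact `K` this is the
distance between the two supporting lines of `K` orthogonal to `u`. -/
def breadth (K : Set Plane) (u : Plane) : ℝ :=
  sSup ((fun x => inner ℝ u x) '' K) - sInf ((fun x => inner ℝ u x) '' K)

/-- The (minimal) width of `K`: the smallest breadth over all unit directions. -/
def width (K : Set Plane) : ℝ :=
  sInf (breadth K '' Metric.sphere (0 : Plane) 1)

/-- The inradius of `K`: the radius of a biggest closed disc (a point has radius `0`) contained in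
`K`. -/
def inradius (K : Set Plane) : ℝ :=
  sSup {ρ : ℝ | 0 ≤ ρ ∧ ∃ c : Plane, Metric.closedBall c ρ ⊆ K}

/-- The circumradius of `K`: the radius of the smallest closed disc containing `K`. -/
def circumradius (K : Set Plane) : ℝ :=
  sInf {ρ : ℝ | 0 ≤ ρ ∧ ∃ c : Plane, K ⊆ Metric.closedBall c ρ}

/-- The diameter of `K`: the biggest distance between two points of `K`. -/
def diameter (K : Set Plane) : ℝ :=
  Metric.diam K

/-- The right-hand side `2r (1 + (2rR/D²) (1 + √(1 - (D/(2R))²)))` for the radii of `K`. -/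
def upperBound (K : Set Plane) : ℝ :=
  2 * inradius K *
    (1 + 2 * inradius K * circumradius K / diameter K ^ 2 *
      (1 + Real.sqrt (1 - (diameter K / (2 * circumradius K)) ^ 2)))

/-- The triangle (with its interior) spanned by three affinely independent points. -/
def triangleBody (t : Affine.Triangle ℝ Plane) : Set Plane :=
  convexHull ℝ (Set.range t.points)

/-- No angle of the triangle exceeds a right angle (acute or right-angled triangles). -/
def NonObtuse (t : Affine.Triangle ℝ Plane) : Prop :=
  ∀ i j k : Fin 3, i ≠ j → i ≠ k → j ≠ k →
    EuclideanGeometry.angle (t.points i) (t.points j) (t.points k) ≤ Real.pi / 2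

/-- All vertices of the triangle lie on the boundary of its smallest enclosing disc. -/
def Circumspherical (t : Affine.Triangle ℝ Plane) : Prop :=
  ∃ c : Plane,
    triangleBody t ⊆ Metric.closedBall c (circumradius (triangleBody t)) ∧
    ∀ i : Fin 3, t.points i ∈ Metric.sphere c (circumradius (triangleBody t))

end PlanarRadii

end

open PlanarRadii

/-! The inequality is clear if w ≤ 2r, so let w > 2r. Take an incircle, with centre the origin. Its
contact normals have the origin in their convex hull, since otherwise the disc could be moved off
its contact points and enlarged. This gives three unit normals uᵢ with ∑ wᵢuᵢ = 0, wᵢ ≥ 0, ∑ wᵢ = 1,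
and w > 2r forces 0 < wᵢ < 1/2. For each i there is a point xᵢ of K at distance at least w from the
supporting line with normal uᵢ.

Let p, q realise the diameter D. Each of them lies in a cone spanned by two of the normals, hence
spoils at most one index, and some i is good for both. For this i, both p and q lie in the angle θ
formed by the tangents from x = xᵢ to the incircle, and in the strip |⟨uᵢ, ·⟩| ≤ r
(`mem_tangent_cone`, `neg_le_inner_of_mem_cone`). Let s be the length of these tangents, so tan(θ/2)
= r/s. Two estimates for the triangle x, p, q, whose longest side is pq, finish the proof. Its
longest side is at most the base that the tangents cut from the far edge of the strip, whence D(w -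
2r) ≤ 2rs (`longest_side_le_base`). If r < s, then θ < π/2, the triangle is not obtuse, and the law
of sines gives D ≤ 2R sin θ (`circumradius_lower_bound`). Eliminating s yields the bound
(`le_upper_bound_of_radii`).

For equality only the reverse inequality is left. In a nonobtuse triangle with longest side c and
doubled area S, the width is at least S/c, while r(a + b + c) ≤ S, R = abc/(2S) and D ≥ c bound the
right-hand side by S/c. -/

/-! ### Triangle estimates in coordinates -/

/-- A disc containing an acute or right triangle `0, v, w` has radius at least the circumradius. -/
theorem circumradius_le_of_nonobtuse {v₁ v₂ w₁ w₂ c₁ c₂ R : ℝ}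
    (hvw : 0 ≤ v₁ * w₁ + v₂ * w₂)
    (hv : 0 ≤ v₁ * (v₁ - w₁) + v₂ * (v₂ - w₂))
    (hw : 0 ≤ w₁ * (w₁ - v₁) + w₂ * (w₂ - v₂))
    (h0 : c₁ ^ 2 + c₂ ^ 2 ≤ R ^ 2)
    (h1 : (v₁ - c₁) ^ 2 + (v₂ - c₂) ^ 2 ≤ R ^ 2)
    (h2 : (w₁ - c₁) ^ 2 + (w₂ - c₂) ^ 2 ≤ R ^ 2)
    (hN : v₁ * w₂ - v₂ * w₁ ≠ 0) :
    (v₁ ^ 2 + v₂ ^ 2) * (w₁ ^ 2 + w₂ ^ 2) * ((v₁ - w₁) ^ 2 + (v₂ - w₂) ^ 2) ≤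
      4 * (v₁ * w₂ - v₂ * w₁) ^ 2 * R ^ 2 := by
  -- Unnormalised barycentric coordinates of the circumcentre, nonnegative because no angle is
  -- obtuse. The identity `id` below is Leibniz's formula: the weighted sum of squared distances
  -- from `c` is smallest when `c` is the circumcentre.
  obtain ⟨a, ha⟩ : ∃ a, a = ((v₁ - w₁) ^ 2 + (v₂ - w₂) ^ 2) * (v₁ * w₁ + v₂ * w₂) := ⟨_, rfl⟩
  obtain ⟨b, hb⟩ : ∃ b, b = (w₁ ^ 2 + w₂ ^ 2) * (v₁ * (v₁ - w₁) + v₂ * (v₂ - w₂)) := ⟨_, rfl⟩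
  obtain ⟨d, hd⟩ : ∃ d, d = (v₁ ^ 2 + v₂ ^ 2) * (w₁ * (w₁ - v₁) + w₂ * (w₂ - v₂)) := ⟨_, rfl⟩
  have a0 : 0 ≤ a := by rw [ha]; positivity
  have b0 : 0 ≤ b := by rw [hb]; positivity
  have d0 : 0 ≤ d := by rw [hd]; positivity
  have e : a + b + d = 2 * (v₁ * w₂ - v₂ * w₁) ^ 2 := by rw [ha, hb, hd]; ring
  have e2 : a * b * (v₁ ^ 2 + v₂ ^ 2) + a * d * (w₁ ^ 2 + w₂ ^ 2)
      + b * d * ((v₁ - w₁) ^ 2 + (v₂ - w₂) ^ 2) = (v₁ * w₂ - v₂ * w₁) ^ 2 *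
        ((v₁ ^ 2 + v₂ ^ 2) * (w₁ ^ 2 + w₂ ^ 2) * ((v₁ - w₁) ^ 2 + (v₂ - w₂) ^ 2)) := by
    have e3 : (v₁ * w₂ - v₂ * w₁) ^ 2 =
        (v₁ * w₁ + v₂ * w₂) * (v₁ * (v₁ - w₁) + v₂ * (v₂ - w₂)) +
        (v₁ * w₁ + v₂ * w₂) * (w₁ * (w₁ - v₁) + w₂ * (w₂ - v₂)) +
        (v₁ * (v₁ - w₁) + v₂ * (v₂ - w₂)) * (w₁ * (w₁ - v₁) + w₂ * (w₂ - v₂)) := by ring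
    rw [ha, hb, hd, e3]
    generalize (v₁ * w₁ + v₂ * w₂) = X
    generalize (v₁ * (v₁ - w₁) + v₂ * (v₂ - w₂)) = Y
    generalize (w₁ * (w₁ - v₁) + w₂ * (w₂ - v₂)) = Z
    generalize ((v₁ - w₁) ^ 2 + (v₂ - w₂) ^ 2) = W
    ring
  have id : (a + b + d) * (a * (c₁ ^ 2 + c₂ ^ 2)
      + b * ((v₁ - c₁) ^ 2 + (v₂ - c₂) ^ 2) + d * ((w₁ - c₁) ^ 2 + (w₂ - c₂) ^ 2))
      = ((a + b + d) * c₁ - b * v₁ - d * w₁) ^ 2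
        + ((a + b + d) * c₂ - b * v₂ - d * w₂) ^ 2
        + (a * b * (v₁ ^ 2 + v₂ ^ 2) + a * d * (w₁ ^ 2 + w₂ ^ 2)
          + b * d * ((v₁ - w₁) ^ 2 + (v₂ - w₂) ^ 2)) := by
    ring
  have key : a * (c₁ ^ 2 + c₂ ^ 2) + b * ((v₁ - c₁) ^ 2 + (v₂ - c₂) ^ 2)
      + d * ((w₁ - c₁) ^ 2 + (w₂ - c₂) ^ 2) ≤ (a + b + d) * R ^ 2 := by
    rw [add_mul, add_mul]
    gcongr
  have h3 := mul_le_mul_of_nonneg_left key (by positivity : 0 ≤ a + b + d)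
  rw [id, e2] at h3
  have hN2 : 0 < (v₁ * w₂ - v₂ * w₁) ^ 2 := by positivity
  have h4 := sq_nonneg ((a + b + d) * c₁ - b * v₁ - d * w₁)
  have h5 := sq_nonneg ((a + b + d) * c₂ - b * v₂ - d * w₂)
  refine le_of_mul_le_mul_left ?_ hN2
  generalize ((a + b + d) * c₁ - b * v₁ - d * w₁) ^ 2 = X at *
  generalize ((a + b + d) * c₂ - b * v₂ - d * w₂) ^ 2 = Y at *
  rw [e] at h3
  generalize (v₁ * w₂ - v₂ * w₁) ^ 2 = N at *
  generalize (v₁ ^ 2 + v₂ ^ 2) * (w₁ ^ 2 + w₂ ^ 2) * ((v₁ - w₁) ^ 2 + (v₂ - w₂) ^ 2) = M at *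
  linarith

/-- Prolonging two sides of a triangle does not shorten its third side if that one is longest. -/
theorem sq_norm_sub_le_of_longest {v₁ v₂ w₁ w₂ l m : ℝ} (hl : 1 ≤ l) (hm : 1 ≤ m)
    (hv : 2 * (v₁ * w₁ + v₂ * w₂) ≤ v₁ ^ 2 + v₂ ^ 2)
    (hw : 2 * (v₁ * w₁ + v₂ * w₂) ≤ w₁ ^ 2 + w₂ ^ 2) :
    (v₁ - w₁) ^ 2 + (v₂ - w₂) ^ 2 ≤ (l * v₁ - m * w₁) ^ 2 + (l * v₂ - m * w₂) ^ 2 := by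
  have aux : ∀ {v₁ v₂ w₁ w₂ l m : ℝ}, 1 ≤ m → m ≤ l →
      2 * (v₁ * w₁ + v₂ * w₂) ≤ v₁ ^ 2 + v₂ ^ 2 →
      (v₁ - w₁) ^ 2 + (v₂ - w₂) ^ 2 ≤ (l * v₁ - m * w₁) ^ 2 + (l * v₂ - m * w₂) ^ 2 := by
    intro v₁ v₂ w₁ w₂ l m hm hl hv
    -- Both sides are prolonged by the smaller factor `m`, then `v` alone by the rest; neither
    -- shortens the third side.
    have e : (l * v₁ - m * w₁) ^ 2 + (l * v₂ - m * w₂) ^ 2 =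
        m ^ 2 * ((v₁ - w₁) ^ 2 + (v₂ - w₂) ^ 2) + (l - m) * (l * (v₁ ^ 2 + v₂ ^ 2)
          + m * (v₁ ^ 2 + v₂ ^ 2 - 2 * (v₁ * w₁ + v₂ * w₂))) := by ring
    have h1 : 0 ≤ (l - m) * (l * (v₁ ^ 2 + v₂ ^ 2)
          + m * (v₁ ^ 2 + v₂ ^ 2 - 2 * (v₁ * w₁ + v₂ * w₂))) :=
      mul_nonneg (by linarith) (add_nonneg (mul_nonneg (by linarith) (by positivity))
        (mul_nonneg (by linarith) (by linarith)))
    have h2 : 1 * ((v₁ - w₁) ^ 2 + (v₂ - w₂) ^ 2) ≤ m ^ 2 * ((v₁ - w₁) ^ 2 + (v₂ - w₂) ^ 2) :=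
      mul_le_mul_of_nonneg_right (by nlinarith) (by positivity)
    linarith
  rcases le_total m l with h | h
  · exact aux hm h hv
  · have := aux (v₁ := w₁) (v₂ := w₂) (w₁ := v₁) (w₂ := v₂) hl h (by linarith)
    linarith

/-- A ray from `x` inside the cone of tangents to the disc of radius `r` about the origin meets the
line at height `-r` between the two tangents. -/
theorem mem_base_of_mem_cone {r s x₁ x₂ v : ℝ} (hr : 0 < r) (hs : 0 < s)
    (hs2 : s ^ 2 = x₁ ^ 2 + x₂ ^ 2 - r ^ 2) (hx : r < x₂)
    (h1 : r * (x₁ * v - x₂ * (x₂ + r)) + s * (-x₁ * (x₂ + r) - x₂ * v) ≤ 0)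
    (h2 : r * (x₁ * v - x₂ * (x₂ + r)) - s * (-x₁ * (x₂ + r) - x₂ * v) ≤ 0) :
    (-(r * x₂) - s * x₁) * (s * x₂ + r * x₁) ≤ (x₂ - r) * v * (x₁ ^ 2 + x₂ ^ 2) ∧
    (x₂ - r) * v * (x₁ ^ 2 + x₂ ^ 2) ≤ (r * x₂ - s * x₁) * (s * x₂ - r * x₁) := by
  have e : (s * x₂ - r * x₁) * (s * x₂ + r * x₁) =
      (x₁ ^ 2 + x₂ ^ 2) * ((x₂ - r) * (x₂ + r)) := by
    have : (s * x₂ - r * x₁) * (s * x₂ + r * x₁) = s ^ 2 * x₂ ^ 2 - r ^ 2 * x₁ ^ 2 := by ring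
    rw [this, hs2]; ring
  have hsx : |x₁| < s := abs_lt_of_sq_lt_sq (by nlinarith) hs.le
  obtain ⟨hx1, hx1'⟩ := abs_lt.mp hsx
  have p1 : 0 < s * x₂ - r * x₁ := by nlinarith
  have p2 : 0 < s * x₂ + r * x₁ := by nlinarith
  have hy : 0 < x₂ + r := by linarith
  constructor
  · have := mul_le_mul_of_nonneg_right h1 p2.le
    refine le_of_mul_le_mul_right ?_ hy
    linear_combination this + v * e
  · have := mul_le_mul_of_nonneg_right h2 p1.le
    refine le_of_mul_le_mul_right ?_ hy
    linear_combination this - v * e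

/-- If `v`, `w` lead from `x` into the triangle formed by the tangents from `x` to the disc of
radius `r` about the origin and by the tangent at height `-r`, and if `v - w` is at least as long as
`v` and `w`, then `v - w` is not longer than the base of that triangle. -/
theorem longest_side_le_base {r s x₁ x₂ v₁ v₂ w₁ w₂ : ℝ} (hr : 0 < r) (hs : 0 < s)
    (hs2 : s ^ 2 = x₁ ^ 2 + x₂ ^ 2 - r ^ 2) (hx : r < x₂)
    (hv₂ : v₂ < 0) (hw₂ : w₂ < 0) (hv₂' : -r ≤ x₂ + v₂) (hw₂' : -r ≤ x₂ + w₂)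
    (hv1 : r * (x₁ * v₁ + x₂ * v₂) + s * (x₁ * v₂ - x₂ * v₁) ≤ 0)
    (hv2 : r * (x₁ * v₁ + x₂ * v₂) - s * (x₁ * v₂ - x₂ * v₁) ≤ 0)
    (hw1 : r * (x₁ * w₁ + x₂ * w₂) + s * (x₁ * w₂ - x₂ * w₁) ≤ 0)
    (hw2 : r * (x₁ * w₁ + x₂ * w₂) - s * (x₁ * w₂ - x₂ * w₁) ≤ 0)
    (hv : 2 * (v₁ * w₁ + v₂ * w₂) ≤ v₁ ^ 2 + v₂ ^ 2)
    (hw : 2 * (v₁ * w₁ + v₂ * w₂) ≤ w₁ ^ 2 + w₂ ^ 2) :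
    ((v₁ - w₁) ^ 2 + (v₂ - w₂) ^ 2) * (x₂ - r) ^ 2 ≤ (2 * r * s) ^ 2 := by
  have hy : 0 < x₂ + r := by linarith
  -- Each vector is prolonged to the line at height `-r`. The difference of the prolonged vectors is
  -- then horizontal and lies within the base, of length `2rs / (x₂ - r)`.
  have scale : ∀ {a b : ℝ}, b < 0 → -r ≤ x₂ + b →
      r * (x₁ * a + x₂ * b) + s * (x₁ * b - x₂ * a) ≤ 0 →
      r * (x₁ * a + x₂ * b) - s * (x₁ * b - x₂ * a) ≤ 0 →
      ∃ l : ℝ, 1 ≤ l ∧ l * b = -(x₂ + r) ∧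
      (-(r * x₂) - s * x₁) * (s * x₂ + r * x₁) ≤ (x₂ - r) * (l * a) * (x₁ ^ 2 + x₂ ^ 2) ∧
      (x₂ - r) * (l * a) * (x₁ ^ 2 + x₂ ^ 2) ≤ (r * x₂ - s * x₁) * (s * x₂ - r * x₁) := by
    intro a b hb hb' h1 h2
    have hl : (x₂ + r) / (-b) * b = -(x₂ + r) := by
      rw [div_neg, neg_mul, div_mul_cancel₀ _ hb.ne]
    have hl1 : 1 ≤ (x₂ + r) / (-b) := by rw [le_div_iff₀ (by linarith)]; linarith
    refine ⟨(x₂ + r) / (-b), hl1, hl, ?_⟩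
    generalize (x₂ + r) / (-b) = l at *
    have g1 := mul_le_mul_of_nonneg_left h1 (by linarith : 0 ≤ l)
    have g2 := mul_le_mul_of_nonneg_left h2 (by linarith : 0 ≤ l)
    have hl' : x₂ + r = -(l * b) := by linarith
    refine mem_base_of_mem_cone hr hs hs2 hx ?_ ?_
    · rw [hl']; linarith
    · rw [hl']; linarith
  obtain ⟨l, hl, hlb, a1, a2⟩ := scale hv₂ hv₂' hv1 hv2
  obtain ⟨m, hm, hmb, b1, b2⟩ := scale hw₂ hw₂' hw1 hw2
  have hle := sq_norm_sub_le_of_longest hl hm hv hw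
  rw [hlb, hmb, sub_self] at hle
  have hL : 0 < x₁ ^ 2 + x₂ ^ 2 := by nlinarith
  have habs : |(x₂ - r) * (l * v₁ - m * w₁)| ≤ 2 * r * s := by
    rw [abs_le]
    constructor
    · refine le_of_mul_le_mul_right ?_ hL
      nlinarith
    · refine le_of_mul_le_mul_right ?_ hL
      nlinarith
  have hsq := sq_le_sq' (abs_le.mp habs).1 (abs_le.mp habs).2
  have := mul_le_mul_of_nonneg_right hle (sq_nonneg (x₂ - r))
  linarith [mul_pow (x₂ - r) (l * v₁ - m * w₁) 2]

/-- Two vectors in the cone of tangents from `x` include at most the angle of that cone. -/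
theorem abs_cross_le_of_mem_cone {r s x₁ x₂ v₁ v₂ w₁ w₂ : ℝ} (hr : 0 < r) (hrs : r < s)
    (hs2 : s ^ 2 = x₁ ^ 2 + x₂ ^ 2 - r ^ 2)
    (hv1 : r * (x₁ * v₁ + x₂ * v₂) + s * (x₁ * v₂ - x₂ * v₁) ≤ 0)
    (hv2 : r * (x₁ * v₁ + x₂ * v₂) - s * (x₁ * v₂ - x₂ * v₁) ≤ 0)
    (hw1 : r * (x₁ * w₁ + x₂ * w₂) + s * (x₁ * w₂ - x₂ * w₁) ≤ 0)
    (hw2 : r * (x₁ * w₁ + x₂ * w₂) - s * (x₁ * w₂ - x₂ * w₁) ≤ 0) :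
    |v₁ * w₂ - v₂ * w₁| * (s ^ 2 - r ^ 2) ≤ 2 * r * s * (v₁ * w₁ + v₂ * w₂) := by
  have hs : 0 < s := hr.trans hrs
  have hL : 0 < x₁ ^ 2 + x₂ ^ 2 := by nlinarith
  -- Here `a`, `b` are the dot and cross products with `x`, so the cone has half-angle `arctan (r /
  -- s)`. The tangent of its full angle is `2rs / (s² - r²)`.
  have aux : ∀ {a₁ b₁ a₂ b₂ : ℝ}, r * a₁ + s * b₁ ≤ 0 → r * a₁ - s * b₁ ≤ 0 →
      r * a₂ + s * b₂ ≤ 0 → r * a₂ - s * b₂ ≤ 0 →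
      (a₁ * b₂ - a₂ * b₁) * (s ^ 2 - r ^ 2) ≤ 2 * r * s * (a₁ * a₂ + b₁ * b₂) := by
    intro a₁ b₁ a₂ b₂ h1 h2 h3 h4
    have q1 := mul_nonneg_of_nonpos_of_nonpos h1 h3
    have q2 := mul_nonneg_of_nonpos_of_nonpos h2 h4
    have q3 := mul_nonneg_of_nonpos_of_nonpos h1 h4
    have q4 := mul_nonneg_of_nonpos_of_nonpos h2 h3
    have hrs' : 0 < 2 * (r * s) := by positivity
    refine le_of_mul_le_mul_left ?_ hrs'
    have d : 0 < s ^ 2 - r ^ 2 := by nlinarith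
    have e : 0 < s ^ 2 + r ^ 2 := by nlinarith
    nlinarith [mul_nonneg d.le q3, mul_nonneg d.le q4, mul_nonneg e.le q1, mul_nonneg e.le q2]
  have i1 : (x₁ ^ 2 + x₂ ^ 2) * (v₁ * w₂ - v₂ * w₁) =
      (x₁ * v₁ + x₂ * v₂) * (x₁ * w₂ - x₂ * w₁) - (x₁ * w₁ + x₂ * w₂) * (x₁ * v₂ - x₂ * v₁) := by
    ring
  have i2 : (x₁ ^ 2 + x₂ ^ 2) * (v₁ * w₁ + v₂ * w₂) =
      (x₁ * v₁ + x₂ * v₂) * (x₁ * w₁ + x₂ * w₂) + (x₁ * v₂ - x₂ * v₁) * (x₁ * w₂ - x₂ * w₁) := by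
    ring
  have k1 := aux hv1 hv2 hw1 hw2
  have k2 := aux hw1 hw2 hv1 hv2
  rw [← i1, ← i2] at k1
  have k2' : -((x₁ ^ 2 + x₂ ^ 2) * (v₁ * w₂ - v₂ * w₁)) * (s ^ 2 - r ^ 2) ≤
      2 * r * s * ((x₁ ^ 2 + x₂ ^ 2) * (v₁ * w₁ + v₂ * w₂)) := by
    rw [i1, i2]; linarith
  rcases abs_cases (v₁ * w₂ - v₂ * w₁) with ⟨h, -⟩ | ⟨h, -⟩ <;> rw [h]
  · refine le_of_mul_le_mul_left ?_ hL; linarith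
  · refine le_of_mul_le_mul_left ?_ hL; linarith

/-- A disc containing a triangle `0, v, w` whose longest side is `v - w` and whose vertex `0` sees
that side within the cone of tangents has a large radius. -/
theorem circumradius_lower_bound {r s x₁ x₂ v₁ v₂ w₁ w₂ c₁ c₂ R D : ℝ} (hr : 0 < r) (hrs : r < s)
    (hs2 : s ^ 2 = x₁ ^ 2 + x₂ ^ 2 - r ^ 2) (hR : 0 ≤ R)
    (hD2 : D ^ 2 = (v₁ - w₁) ^ 2 + (v₂ - w₂) ^ 2)
    (hv0 : 0 < v₁ ^ 2 + v₂ ^ 2) (hw0 : 0 < w₁ ^ 2 + w₂ ^ 2)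
    (hv1 : r * (x₁ * v₁ + x₂ * v₂) + s * (x₁ * v₂ - x₂ * v₁) ≤ 0)
    (hv2 : r * (x₁ * v₁ + x₂ * v₂) - s * (x₁ * v₂ - x₂ * v₁) ≤ 0)
    (hw1 : r * (x₁ * w₁ + x₂ * w₂) + s * (x₁ * w₂ - x₂ * w₁) ≤ 0)
    (hw2 : r * (x₁ * w₁ + x₂ * w₂) - s * (x₁ * w₂ - x₂ * w₁) ≤ 0)
    (hv : 2 * (v₁ * w₁ + v₂ * w₂) ≤ v₁ ^ 2 + v₂ ^ 2)
    (hw : 2 * (v₁ * w₁ + v₂ * w₂) ≤ w₁ ^ 2 + w₂ ^ 2)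
    (h0 : c₁ ^ 2 + c₂ ^ 2 ≤ R ^ 2)
    (h1 : (v₁ - c₁) ^ 2 + (v₂ - c₂) ^ 2 ≤ R ^ 2)
    (h2 : (w₁ - c₁) ^ 2 + (w₂ - c₂) ^ 2 ≤ R ^ 2) :
    D * (s ^ 2 + r ^ 2) ≤ 4 * r * s * R := by
  have hs : 0 < s := hr.trans hrs
  have hcr := abs_cross_le_of_mem_cone hr hrs hs2 hv1 hv2 hw1 hw2
  have d : 0 < s ^ 2 - r ^ 2 := sub_pos.2 (pow_lt_pow_left₀ hrs hr.le two_ne_zero)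
  have hdot : 0 ≤ v₁ * w₁ + v₂ * w₂ := by
    have : 0 ≤ 2 * r * s * (v₁ * w₁ + v₂ * w₂) := (mul_nonneg (abs_nonneg _) d.le).trans hcr
    exact nonneg_of_mul_nonneg_right this (by positivity)
  have lag : (v₁ ^ 2 + v₂ ^ 2) * (w₁ ^ 2 + w₂ ^ 2) =
      (v₁ * w₂ - v₂ * w₁) ^ 2 + (v₁ * w₁ + v₂ * w₂) ^ 2 := by ring
  -- Excludes a degenerate triangle: for parallel `v`, `w`, Lagrange's identity would make the
  -- right-hand side equal to `(v · w)²`.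
  have hprod : 4 * (v₁ * w₁ + v₂ * w₂) ^ 2 ≤ (v₁ ^ 2 + v₂ ^ 2) * (w₁ ^ 2 + w₂ ^ 2) := by
    have := mul_le_mul hv hw (by positivity) hv0.le
    linarith
  have hN : v₁ * w₂ - v₂ * w₁ ≠ 0 := by
    intro h
    rw [h] at lag
    have := mul_pos hv0 hw0
    linarith
  have hN2 : 0 < (v₁ * w₂ - v₂ * w₁) ^ 2 := by positivity
  have hR2 := circumradius_le_of_nonobtuse hdot (by linarith) (by linarith) h0 h1 h2 hN
  rw [← hD2, lag] at hR2
  have hsq := pow_le_pow_left₀ (mul_nonneg (abs_nonneg _) d.le) hcr 2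
  rw [mul_pow, sq_abs] at hsq
  refine le_of_sq_le_sq ?_ (by positivity)
  refine le_of_mul_le_mul_left ?_ hN2
  have k1 := mul_le_mul_of_nonneg_left hR2 (by positivity : 0 ≤ 4 * (r * s) ^ 2)
  have k2 := mul_le_mul_of_nonneg_left hsq (sq_nonneg D)
  generalize (v₁ * w₂ - v₂ * w₁) ^ 2 = N at *
  generalize v₁ * w₁ + v₂ * w₂ = X at *
  linear_combination k1 + k2

/-- Put sin θ = 2rs/(s² + r²). For `r < s`, `hRs` says D/(2R) ≤ sin θ, so (D/(2R)) cot θ ≤ √(1 -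
(D/(2R))²); this bounds `s` from above. For `s ≤ r`, D ≤ 2R suffices. -/
theorem le_upper_bound_of_radii {r s t R D : ℝ} (hr : 0 < r) (hs : 0 < s) (hD : 0 < D)
    (hR : D ≤ 2 * R) (ht : D * t ≤ 2 * r * s)
    (hRs : r < s → D * (s ^ 2 + r ^ 2) ≤ 4 * r * s * R) :
    2 * r + t ≤ 2 * r * (1 + 2 * r * R / D ^ 2 * (1 + √(1 - (D / (2 * R)) ^ 2))) := by
  have hR0 : 0 < R := by linarith
  have key : D * s ≤ 2 * r * (R * (1 + √(1 - (D / (2 * R)) ^ 2))) := by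
    rcases le_or_gt s r with h | h
    · have : 0 ≤ R * √(1 - (D / (2 * R)) ^ 2) := by positivity
      nlinarith
    · have h1 := hRs h
      have h2 : D * (s ^ 2 - r ^ 2) / (4 * r * s * R) ≤ √(1 - (D / (2 * R)) ^ 2) := by
        apply Real.le_sqrt_of_sq_le
        have h3 : D ^ 2 * (s ^ 2 + r ^ 2) ^ 2 ≤ (4 * r * s * R) ^ 2 := by
          rw [← mul_pow]; exact pow_le_pow_left₀ (by positivity) h1 2
        rw [div_pow, div_pow, div_le_iff₀ (by positivity)]
        have e : (1 - D ^ 2 / (2 * R) ^ 2) * (4 * r * s * R) ^ 2 =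
            (4 * r * s * R) ^ 2 - 4 * (r * s) ^ 2 * D ^ 2 := by field_simp; ring
        rw [e]; nlinarith
      rw [div_le_iff₀ (by positivity)] at h2
      refine le_of_mul_le_mul_left ?_ (by positivity : 0 < 2 * s)
      nlinarith
  have e : 2 * r * (1 + 2 * r * R / D ^ 2 * (1 + √(1 - (D / (2 * R)) ^ 2))) = 2 * r +
      2 * r * (2 * r * (R * (1 + √(1 - (D / (2 * R)) ^ 2)))) / D ^ 2 := by ring
  rw [e]
  gcongr
  rw [le_div_iff₀ (by positivity)]
  nlinarith

/-! ### Contact points of an incircle -/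

theorem exists_unit_separating {K : Set Plane} (hK : Convex ℝ K) (hc : IsClosed K)
    (hne : K.Nonempty) {z : Plane} (hz : z ∉ K) :
    ∃ u : Plane, ‖u‖ = 1 ∧ ∀ y ∈ K, inner ℝ u y ≤ inner ℝ u z := by
  obtain ⟨f, a, hf, ha⟩ := geometric_hahn_banach_closed_point hK hc hz
  set g := (InnerProductSpace.toDual ℝ Plane).symm f with hg
  have hgf : ∀ y, inner ℝ g y = f y := fun y => InnerProductSpace.toDual_symm_apply
  have hg0 : 0 < ‖g‖ := by
    rw [norm_pos_iff]
    intro h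
    obtain ⟨y, hy⟩ := hne
    have h1 := hf y hy
    rw [← hgf, h, inner_zero_left] at h1
    rw [← hgf, h, inner_zero_left] at ha
    linarith
  refine ⟨‖g‖⁻¹ • g, ?_, fun y hy => ?_⟩
  · rw [norm_smul, norm_inv, norm_norm, inv_mul_cancel₀ hg0.ne']
  · rw [real_inner_smul_left, real_inner_smul_left, hgf, hgf]
    have := hf y hy
    gcongr
    linarith

/-- The inradius is attained. -/
theorem exists_incircle (K : ConvexBody Plane) :
    ∃ c ∈ K, 0 ≤ inradius K ∧ Metric.closedBall c (inradius K) ⊆ (K : Set Plane) ∧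
      ∀ c' : Plane, Metric.infDist c' (K : Set Plane)ᶜ ≤ inradius K := by
  have hne : ((K : Set Plane)ᶜ).Nonempty := Set.nonempty_compl.2 K.isCompact.ne_univ
  obtain ⟨c, hc, hmax⟩ := K.isCompact.exists_isMaxOn K.nonempty
    (Metric.continuous_infDist_pt (K : Set Plane)ᶜ).continuousOn
  have hball : Metric.closedBall c (Metric.infDist c (K : Set Plane)ᶜ) ⊆ (K : Set Plane) := by
    rcases eq_or_ne (Metric.infDist c (K : Set Plane)ᶜ) 0 with h | h
    · rw [h, Metric.closedBall_zero]
      exact Set.singleton_subset_iff.2 hc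
    · rw [← closure_ball c h]
      exact closure_minimal Metric.ball_infDist_compl_subset K.isClosed
  have hr : inradius K = Metric.infDist c (K : Set Plane)ᶜ := by
    refine IsGreatest.csSup_eq ⟨⟨Metric.infDist_nonneg, c, hball⟩, ?_⟩
    rintro ρ ⟨hρ, c', hc'⟩
    refine le_trans ?_ (hmax (hc' (Metric.mem_closedBall_self hρ)))
    refine (Metric.le_infDist hne).2 fun {y} hy => ?_
    by_contra h
    exact hy (hc' (Metric.mem_closedBall'.2 (not_le.1 h).le))
  refine ⟨c, hc, hr ▸ Metric.infDist_nonneg, hr ▸ hball, fun c' => ?_⟩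
  by_cases h : c' ∈ K
  · exact hr ▸ hmax h
  · rw [Metric.infDist_zero_of_mem (show c' ∈ (K : Set Plane)ᶜ from h), hr]
    exact Metric.infDist_nonneg

/-- The outer unit normals of the lines supporting both `K` and its disc of radius `r` about `c`. -/
def contactNormals (K : Set Plane) (c : Plane) (r : ℝ) : Set Plane :=
  {u | ‖u‖ = 1 ∧ ∀ z ∈ K, inner ℝ u (z - c) ≤ r}

theorem isCompact_contactNormals (K : Set Plane) (c : Plane) (r : ℝ) :
    IsCompact (contactNormals K c r) := by
  refine (isCompact_sphere (0 : Plane) 1).of_isClosed_subset ?_ fun u hu => by simpa using hu.1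
  have : contactNormals K c r =
      {u | ‖u‖ = 1} ∩ ⋂ z ∈ K, {u : Plane | inner ℝ u (z - c) ≤ r} := by
    ext u; simp [contactNormals]
  rw [this]
  refine (isClosed_eq continuous_norm continuous_const).inter (isClosed_biInter fun z _ => ?_)
  exact isClosed_le (by fun_prop) continuous_const

theorem inner_sub_le_of_closedBall_subset {K : Set Plane} {c : Plane} {r : ℝ} (hr : 0 ≤ r)
    (hball : Metric.closedBall c r ⊆ K) {u : Plane} (hu : ‖u‖ = 1) {b : ℝ}
    (hb : ∀ z ∈ K, inner ℝ u (z - c) ≤ b) : r ≤ b := by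
  have := hb (c + r • u) (hball (by simp [norm_smul, hu, abs_of_nonneg hr]))
  simpa [real_inner_smul_right, hu] using this

/-- An incircle cannot be moved off its contact points in any direction. -/
theorem exists_contactNormal_inner_nonneg (K : ConvexBody Plane) {c : Plane}
    (h0 : 0 ≤ inradius K) (hball : Metric.closedBall c (inradius K) ⊆ (K : Set Plane))
    (hmax : ∀ c' : Plane, Metric.infDist c' (K : Set Plane)ᶜ ≤ inradius K) (v : Plane) :
    ∃ u ∈ contactNormals K c (inradius K), 0 ≤ inner ℝ u v := by
  have hne : ((K : Set Plane)ᶜ).Nonempty := Set.nonempty_compl.2 K.isCompact.ne_univ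
  set r := inradius K with hr
  -- The disc is moved by `ε v`. Some point outside `K` lies within `r + ε²` of the new centre; a
  -- line separates it from `K`. The slack `ε²` is of second order, so that division by `ε` still
  -- leaves an error tending to zero.
  have key : ∀ n : ℕ, ∃ u : Plane, ‖u‖ = 1 ∧ -(1 / ((n : ℝ) + 1)) ≤ inner ℝ u v ∧
      ∀ z ∈ K, inner ℝ u (z - c) ≤
        r + 1 / ((n : ℝ) + 1) * ‖v‖ + (1 / ((n : ℝ) + 1)) ^ 2 := by
    intro n
    have hε : 0 < 1 / ((n : ℝ) + 1) := by positivity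
    set ε := 1 / ((n : ℝ) + 1)
    obtain ⟨z, hz, hzd⟩ := (Metric.infDist_lt_iff hne).1
      ((hmax (c + ε • v)).trans_lt (lt_add_of_pos_right r (pow_pos hε 2)))
    obtain ⟨u, hu, huz⟩ := exists_unit_separating K.convex K.isClosed K.nonempty hz
    have hle : ∀ y ∈ K, inner ℝ u (y - c) ≤ ε * inner ℝ u v + (r + ε ^ 2) := by
      intro y hy
      have e : z - c = ε • v + (z - (c + ε • v)) := by abel
      have h1 : inner ℝ u (y - c) ≤ inner ℝ u (z - c) := by
        rw [inner_sub_right, inner_sub_right]; linarith [huz y hy]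
      have h2 : inner ℝ u (z - (c + ε • v)) ≤ r + ε ^ 2 := by
        refine (real_inner_le_norm _ _).trans ?_
        rw [hu, one_mul, ← dist_eq_norm, dist_comm]
        exact hzd.le
      rw [e, inner_add_right, real_inner_smul_right] at h1
      linarith
    refine ⟨u, hu, ?_, fun y hy => (hle y hy).trans ?_⟩
    · have := inner_sub_le_of_closedBall_subset h0 hball hu hle
      refine le_of_mul_le_mul_left ?_ hε
      linarith
    · have h3 : inner ℝ u v ≤ ‖v‖ := by simpa [hu] using real_inner_le_norm u v
      have := mul_le_mul_of_nonneg_left h3 hε.le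
      linarith
  choose u hu hv hK using key
  obtain ⟨w, hw, φ, hφ, hlim⟩ := (isCompact_sphere (0 : Plane) 1).tendsto_subseq
    (x := u) fun n => by simpa using hu n
  have hε : Filter.Tendsto (fun n => 1 / ((φ n : ℝ) + 1)) Filter.atTop (nhds 0) :=
    tendsto_one_div_add_atTop_nhds_zero_nat.comp hφ.tendsto_atTop
  refine ⟨w, ⟨by simpa using hw, fun z hz => ?_⟩, ?_⟩
  · have h1 : Filter.Tendsto (fun n => inner ℝ (u (φ n)) (z - c)) Filter.atTop
        (nhds (inner ℝ w (z - c))) := hlim.inner tendsto_const_nhds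
    have h2 := (tendsto_const_nhds (x := r)).add (hε.mul_const ‖v‖) |>.add (hε.pow 2)
    simpa using le_of_tendsto_of_tendsto' h1 h2 fun n => hK (φ n) z hz
  · have h1 : Filter.Tendsto (fun n => inner ℝ (u (φ n)) v) Filter.atTop
        (nhds (inner ℝ w v)) := hlim.inner tendsto_const_nhds
    simpa using le_of_tendsto_of_tendsto' hε.neg h1 fun n => hv (φ n)

/-- By Carathéodory's theorem the hull lies in the continuous image of the compact set of triples of
weights and points, and this image is closed. -/
theorem closure_convexHull_subset_image {U : Set Plane} (hU : IsCompact U) {x : Plane}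
    (hx : x ∈ closure (convexHull ℝ U)) :
    ∃ (w : Fin 3 → ℝ) (z : Fin 3 → Plane), (∀ i, 0 ≤ w i) ∧ ∑ i, w i = 1 ∧ (∀ i, z i ∈ U) ∧
      ∑ i, w i • z i = x := by
  have hcpt : IsCompact ((fun a : (Fin 3 → ℝ) × (Fin 3 → Plane) => ∑ i, a.1 i • a.2 i) ''
      (stdSimplex ℝ (Fin 3) ×ˢ Set.univ.pi fun _ => U)) :=
    ((isCompact_stdSimplex ℝ (Fin 3)).prod (isCompact_univ_pi fun _ => hU)).image (by fun_prop)
  have hsub : convexHull ℝ U ⊆ (fun a : (Fin 3 → ℝ) × (Fin 3 → Plane) => ∑ i, a.1 i • a.2 i) ''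
      (stdSimplex ℝ (Fin 3) ×ˢ Set.univ.pi fun _ => U) := by
    intro y hy
    obtain ⟨z₀, hz₀⟩ := convexHull_nonempty_iff.1 ⟨y, hy⟩
    obtain ⟨ι, _, z, w, hzU, hai, hw, hw1, hwz⟩ := eq_pos_convex_span_of_mem_convexHull hy
    have hcard : Fintype.card ι ≤ Fintype.card (Fin 3) := by
      have := hai.card_le_finrank_succ
      have h2 := Submodule.finrank_le (vectorSpan ℝ (Set.range z))
      simp at h2 ⊢
      omega
    obtain ⟨e⟩ := Function.Embedding.nonempty_of_card_le hcard
    -- Carathéodory may use fewer than three points; the missing ones are filled with `z₀` at weight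
    -- zero.
    refine ⟨(Function.extend e w 0, Function.extend e z fun _ => z₀), ⟨⟨fun i => ?_, ?_⟩, ?_⟩, ?_⟩
    · by_cases h : ∃ j, e j = i
      · obtain ⟨j, rfl⟩ := h
        simpa [e.injective.extend_apply] using (hw j).le
      · simp [Function.extend_apply' _ _ _ h]
    · rw [← hw1]
      refine (Fintype.sum_of_injective e e.injective _ _ (fun i hi => ?_) fun j => ?_).symm
      · exact Function.extend_apply' _ _ _ hi
      · simp [e.injective.extend_apply]
    · intro i _
      by_cases h : ∃ j, e j = i
      · obtain ⟨j, rfl⟩ := h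
        simpa [e.injective.extend_apply] using hzU ⟨j, rfl⟩
      · simpa [Function.extend_apply' _ _ _ h] using hz₀
    · rw [← hwz]
      refine (Fintype.sum_of_injective e e.injective _ _ (fun i hi => ?_) fun j => ?_).symm
      · dsimp only
        rw [Function.extend_apply' w _ i hi, Pi.zero_apply, zero_smul]
      · simp [e.injective.extend_apply]
  obtain ⟨⟨w, z⟩, ⟨⟨hw, hw1⟩, hz⟩, rfl⟩ := closure_minimal hsub hcpt.isClosed hx
  exact ⟨w, z, hw, hw1, fun i => hz i trivial, rfl⟩

/-- The normals at the contact points of an incircle surround the origin. -/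
theorem exists_contactNormals_sum_eq_zero (K : ConvexBody Plane) {c : Plane}
    (h0 : 0 ≤ inradius K) (hball : Metric.closedBall c (inradius K) ⊆ (K : Set Plane))
    (hmax : ∀ c' : Plane, Metric.infDist c' (K : Set Plane)ᶜ ≤ inradius K) :
    ∃ (w : Fin 3 → ℝ) (u : Fin 3 → Plane), (∀ i, 0 ≤ w i) ∧ ∑ i, w i = 1 ∧
      (∀ i, u i ∈ contactNormals K c (inradius K)) ∧ ∑ i, w i • u i = 0 := by
  refine closure_convexHull_subset_image (isCompact_contactNormals _ _ _) ?_
  by_contra h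
  obtain ⟨f, a, hfa, hf⟩ :=
    geometric_hahn_banach_closed_point (convex_convexHull ℝ _).closure isClosed_closure h
  obtain ⟨u, hu, huv⟩ := exists_contactNormal_inner_nonneg K h0 hball hmax
    ((InnerProductSpace.toDual ℝ Plane).symm f)
  rw [real_inner_comm, InnerProductSpace.toDual_symm_apply] at huv
  have := hfa u (subset_closure (subset_convexHull ℝ _ hu))
  rw [map_zero] at hf
  linarith

/-! ### The diametral pair inside a tangent cone -/

theorem inner_le_one_of_unit {a₁ a₂ b₁ b₂ : ℝ} (ha : a₁ ^ 2 + a₂ ^ 2 = 1)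
    (hb : b₁ ^ 2 + b₂ ^ 2 = 1) : a₁ * b₁ + a₂ * b₂ ≤ 1 := by
  nlinarith [sq_nonneg (a₁ - b₁), sq_nonneg (a₂ - b₂)]

/-- The normal `n` of a tangent line through `x` does not lie between the normals `a`, `b` of two
tangent lines if `x` is beyond the disc as seen from the first and on the near side of the second. -/
theorem tangent_normal_not_between {r a₁ a₂ b₁ b₂ n₁ n₂ x₁ x₂ : ℝ} (hr : 0 ≤ r)
    (ha : a₁ ^ 2 + a₂ ^ 2 = 1) (hb : b₁ ^ 2 + b₂ ^ 2 = 1) (hn : n₁ ^ 2 + n₂ ^ 2 = 1)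
    (hnx : n₁ * x₁ + n₂ * x₂ = r) (hax : a₁ * x₁ + a₂ * x₂ < -r)
    (hbx : b₁ * x₁ + b₂ * x₂ ≤ r) :
    n₁ * (a₁ + b₁) + n₂ * (a₂ + b₂) ≤ 1 + (a₁ * b₁ + a₂ * b₂) := by
  obtain ⟨c, hc⟩ : ∃ c, c = a₁ * b₁ + a₂ * b₂ := ⟨_, rfl⟩
  have hc1 : c ≤ 1 := hc ▸ inner_le_one_of_unit ha hb
  have hna := inner_le_one_of_unit hn ha
  have hnb := inner_le_one_of_unit hn hb
  have hc0 : 0 ≤ 1 + c := by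
    rw [hc]; nlinarith [sq_nonneg (a₁ + b₁), sq_nonneg (a₂ + b₂)]
  rw [← hc]
  by_cases hd : a₁ * b₂ - a₂ * b₁ = 0
  · have hcc : (1 - c) * (1 + c) = 0 := by
      have : c ^ 2 + (a₁ * b₂ - a₂ * b₁) ^ 2 = (a₁ ^ 2 + a₂ ^ 2) * (b₁ ^ 2 + b₂ ^ 2) := by
        rw [hc]; ring
      rw [hd, ha, hb] at this
      linarith
    rcases mul_eq_zero.1 hcc with h | h
    · linarith
    · have h0 : (a₁ + b₁) ^ 2 + (a₂ + b₂) ^ 2 = 0 := by linear_combination ha + hb + 2 * h - 2 * hc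
      have h1 : a₁ + b₁ = 0 := by nlinarith [sq_nonneg (a₁ + b₁), sq_nonneg (a₂ + b₂)]
      have h2 : a₂ + b₂ = 0 := by nlinarith [sq_nonneg (a₁ + b₁), sq_nonneg (a₂ + b₂)]
      rw [h1, h2, h]; simp
  · obtain ⟨l, hl⟩ : ∃ l, l = (n₁ * b₂ - n₂ * b₁) / (a₁ * b₂ - a₂ * b₁) := ⟨_, rfl⟩
    obtain ⟨m, hm⟩ : ∃ m, m = (a₁ * n₂ - a₂ * n₁) / (a₁ * b₂ - a₂ * b₁) := ⟨_, rfl⟩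
    have e1 : n₁ = l * a₁ + m * b₁ := by
      rw [hl, hm, div_mul_eq_mul_div, div_mul_eq_mul_div, ← add_div, eq_div_iff hd]; ring
    have e2 : n₂ = l * a₂ + m * b₂ := by
      rw [hl, hm, div_mul_eq_mul_div, div_mul_eq_mul_div, ← add_div, eq_div_iff hd]; ring
    have hlm : l ^ 2 + m ^ 2 + 2 * l * m * c = 1 := by
      rw [e1, e2] at hn; rw [hc]; linear_combination hn - l ^ 2 * ha - m ^ 2 * hb
    -- If `l`, `m` have opposite signs, this follows from |n| = 1. If both are positive, |n| = 1
    -- gives `m - l ≤ 1`, and pairing `n = l a + m b` with `x` gives `r < (m - l) r`, a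
    -- contradiction.
    have hsum : l + m ≤ 1 := by
      rcases le_or_gt (l * m) 0 with h | h
      · nlinarith [mul_nonneg (neg_nonneg.2 h) (sub_nonneg.2 hc1)]
      · rcases le_or_gt l 0 with hl0 | hl0
        · have : m ≤ 0 := by nlinarith
          linarith
        · have hm0 : 0 < m := pos_of_mul_pos_right h hl0.le
          have hml : m - l ≤ 1 := by nlinarith [mul_nonneg h.le hc0]
          have hx : r = l * (a₁ * x₁ + a₂ * x₂) + m * (b₁ * x₁ + b₂ * x₂) := by
            rw [← hnx, e1, e2]; ring
          have k1 := mul_lt_mul_of_pos_left hax hl0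
          have k2 := mul_le_mul_of_nonneg_left hbx hm0.le
          have k3 := mul_le_mul_of_nonneg_left hml hr
          linarith
    have e3 : n₁ * (a₁ + b₁) + n₂ * (a₂ + b₂) = (l + m) * (1 + c) := by
      rw [e1, e2, hc]; linear_combination l * ha + m * hb
    rw [e3]
    nlinarith

/-- A point of the wedge between two tangent lines which lies in the cone of their normals is
on the near side of every tangent line through `x`. -/
theorem mem_tangent_halfplane {r a₁ a₂ b₁ b₂ n₁ n₂ x₁ x₂ α β : ℝ} (hr : 0 ≤ r)
    (ha : a₁ ^ 2 + a₂ ^ 2 = 1) (hb : b₁ ^ 2 + b₂ ^ 2 = 1) (hn : n₁ ^ 2 + n₂ ^ 2 = 1)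
    (hnx : n₁ * x₁ + n₂ * x₂ = r) (hax : a₁ * x₁ + a₂ * x₂ < -r)
    (hbx : b₁ * x₁ + b₂ * x₂ ≤ r) (hα : 0 ≤ α) (hβ : 0 ≤ β)
    (hap : a₁ * (α * a₁ + β * b₁) + a₂ * (α * a₂ + β * b₂) ≤ r)
    (hbp : b₁ * (α * a₁ + β * b₁) + b₂ * (α * a₂ + β * b₂) ≤ r) :
    n₁ * (α * a₁ + β * b₁) + n₂ * (α * a₂ + β * b₂) ≤ r := by
  have h := tangent_normal_not_between hr ha hb hn hnx hax hbx
  have e1 : a₁ * (α * a₁ + β * b₁) + a₂ * (α * a₂ + β * b₂) =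
      α + β * (a₁ * b₁ + a₂ * b₂) := by linear_combination α * ha
  have e2 : b₁ * (α * a₁ + β * b₁) + b₂ * (α * a₂ + β * b₂) =
      α * (a₁ * b₁ + a₂ * b₂) + β := by linear_combination β * hb
  rw [e1] at hap
  rw [e2] at hbp
  -- The point is split into a multiple of `a + b` by the smaller coefficient and a remainder along
  -- `a` or `b`.
  rcases le_total β α with hle | hle
  · have k1 := mul_le_mul_of_nonneg_left h hβ
    have k2 := mul_le_mul_of_nonneg_left (inner_le_one_of_unit hn ha) (sub_nonneg.2 hle)
    linarith
  · have k1 := mul_le_mul_of_nonneg_left h hα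
    have k2 := mul_le_mul_of_nonneg_left (inner_le_one_of_unit hn hb) (sub_nonneg.2 hle)
    linarith

/-- The tangent through `x` has unit normal `(r x + s x^⊥) / |x|²`, with `x^⊥ = (-x₂, x₁)`. Only
`s²` is prescribed, so the two signs of `s` give the two tangents. -/
theorem mem_tangent_cone {r s a₁ a₂ b₁ b₂ x₁ x₂ p₁ p₂ α β : ℝ} (hr : 0 ≤ r)
    (ha : a₁ ^ 2 + a₂ ^ 2 = 1) (hb : b₁ ^ 2 + b₂ ^ 2 = 1)
    (hL : 0 < x₁ ^ 2 + x₂ ^ 2) (hs2 : s ^ 2 = x₁ ^ 2 + x₂ ^ 2 - r ^ 2)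
    (hax : a₁ * x₁ + a₂ * x₂ < -r) (hbx : b₁ * x₁ + b₂ * x₂ ≤ r) (hα : 0 ≤ α) (hβ : 0 ≤ β)
    (hp₁ : p₁ = α * a₁ + β * b₁) (hp₂ : p₂ = α * a₂ + β * b₂)
    (hap : a₁ * p₁ + a₂ * p₂ ≤ r) (hbp : b₁ * p₁ + b₂ * p₂ ≤ r) :
    r * (x₁ * (p₁ - x₁) + x₂ * (p₂ - x₂)) + s * (x₁ * (p₂ - x₂) - x₂ * (p₁ - x₁)) ≤ 0 := by
  have hsum : s ^ 2 + r ^ 2 = x₁ ^ 2 + x₂ ^ 2 := by linarith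
  subst hp₁ hp₂
  have h := mem_tangent_halfplane (n₁ := (r * x₁ - s * x₂) / (x₁ ^ 2 + x₂ ^ 2))
    (n₂ := (r * x₂ + s * x₁) / (x₁ ^ 2 + x₂ ^ 2)) hr ha hb (by
      field_simp; linear_combination (x₁ ^ 2 + x₂ ^ 2) * hsum) (by field_simp; ring) hax hbx hα hβ hap hbp
  rw [div_mul_eq_mul_div, div_mul_eq_mul_div, ← add_div, div_le_iff₀ hL] at h
  linarith

/-- The sum `a · p + b · p = (α + β)(1 + a · b)` is nonnegative. -/
theorem neg_le_inner_of_mem_cone {r a₁ a₂ b₁ b₂ p₁ p₂ α β : ℝ}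
    (ha : a₁ ^ 2 + a₂ ^ 2 = 1) (hb : b₁ ^ 2 + b₂ ^ 2 = 1) (hα : 0 ≤ α) (hβ : 0 ≤ β)
    (hp₁ : p₁ = α * a₁ + β * b₁) (hp₂ : p₂ = α * a₂ + β * b₂)
    (hbp : b₁ * p₁ + b₂ * p₂ ≤ r) : -r ≤ a₁ * p₁ + a₂ * p₂ := by
  have hc0 : 0 ≤ 1 + (a₁ * b₁ + a₂ * b₂) := by
    nlinarith [sq_nonneg (a₁ + b₁), sq_nonneg (a₂ + b₂)]
  have e1 : a₁ * p₁ + a₂ * p₂ = α + β * (a₁ * b₁ + a₂ * b₂) := by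
    rw [hp₁, hp₂]; linear_combination α * ha
  have e2 : b₁ * p₁ + b₂ * p₂ = α * (a₁ * b₁ + a₂ * b₂) + β := by
    rw [hp₁, hp₂]; linear_combination β * hb
  rw [e2] at hbp
  rw [e1]
  have := mul_nonneg (add_nonneg hα hβ) hc0
  linarith

theorem sum_three_eq (f : Fin 3 → ℝ) {i j k : Fin 3} (hik : i ≠ k) (hjk : j ≠ k) (hji : j ≠ i) :
    f 0 + f 1 + f 2 = f i + f j + f k := by
  have : (Finset.univ : Finset (Fin 3)) = {i, j, k} := by decide +revert
  rw [← Fin.sum_univ_three, this, Finset.sum_insert (by simp [hik, hji.symm]),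
    Finset.sum_pair hjk, add_assoc]

/-- Three positively dependent unit vectors in general position: every vector is a nonnegative
combination of two of them. -/
theorem exists_label {a b w : Fin 3 → ℝ} (hu : ∀ i, a i ^ 2 + b i ^ 2 = 1)
    (hw : ∀ i, 0 < w i) (hw' : ∀ i, w i < 1 / 2) (hw1 : ∑ i, w i = 1)
    (ha : ∑ i, w i * a i = 0) (hb : ∑ i, w i * b i = 0) (p₁ p₂ : ℝ) :
    ∃ k : Fin 3, ∀ i, i ≠ k → ∃ j, ∃ α β : ℝ, 0 ≤ α ∧ 0 ≤ β ∧
      p₁ = α * a i + β * a j ∧ p₂ = α * b i + β * b j := by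
  simp only [Fin.sum_univ_three] at hw1 ha hb
  -- If two normals were parallel, the third weight would be the sum or the difference of the first
  -- two up to sign; weights in (0, 1/2) with sum 1 forbid this.
  have hd : a 0 * b 1 - a 1 * b 0 ≠ 0 := by
    intro hd
    have h2 : w 2 ^ 2 = w 0 ^ 2 + w 1 ^ 2 + 2 * w 0 * w 1 * (a 0 * a 1 + b 0 * b 1) := by
      have e1 : w 2 * a 2 = -(w 0 * a 0 + w 1 * a 1) := by linarith
      have e2 : w 2 * b 2 = -(w 0 * b 0 + w 1 * b 1) := by linarith
      have : w 2 ^ 2 = (w 2 * a 2) ^ 2 + (w 2 * b 2) ^ 2 := by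
        linear_combination -(w 2 ^ 2) * hu 2
      rw [this, e1, e2]
      linear_combination w 0 ^ 2 * hu 0 + w 1 ^ 2 * hu 1
    have hcc : (a 0 * a 1 + b 0 * b 1 - 1) * (a 0 * a 1 + b 0 * b 1 + 1) = 0 := by
      have : (a 0 * a 1 + b 0 * b 1) ^ 2 + (a 0 * b 1 - a 1 * b 0) ^ 2 =
          (a 0 ^ 2 + b 0 ^ 2) * (a 1 ^ 2 + b 1 ^ 2) := by ring
      rw [hd, hu, hu] at this
      linarith
    rcases mul_eq_zero.1 hcc with h | h
    · have : (w 2 - (w 0 + w 1)) * (w 2 + (w 0 + w 1)) = 0 := by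
        linear_combination h2 + 2 * w 0 * w 1 * h
      rcases mul_eq_zero.1 this with h | h <;> linarith [hw 0, hw 1, hw 2, hw' 2]
    · have : (w 2 - (w 0 - w 1)) * (w 2 + (w 0 - w 1)) = 0 := by
        linear_combination h2 + 2 * w 0 * w 1 * h
      rcases mul_eq_zero.1 this with h | h <;> linarith [hw' 0, hw' 1]
  obtain ⟨g, hg1, hg2⟩ : ∃ g : Fin 3 → ℝ, p₁ = g 0 * a 0 + g 1 * a 1 + g 2 * a 2 ∧
      p₂ = g 0 * b 0 + g 1 * b 1 + g 2 * b 2 := by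
    refine ⟨![(p₁ * b 1 - p₂ * a 1) / (a 0 * b 1 - a 1 * b 0),
      (a 0 * p₂ - b 0 * p₁) / (a 0 * b 1 - a 1 * b 0), 0], ?_, ?_⟩
    · simp only [Matrix.cons_val, zero_mul, add_zero]
      rw [div_mul_eq_mul_div, div_mul_eq_mul_div, ← add_div, eq_div_iff hd]; ring
    · simp only [Matrix.cons_val, zero_mul, add_zero]
      rw [div_mul_eq_mul_div, div_mul_eq_mul_div, ← add_div, eq_div_iff hd]; ring
  -- Subtracting the dependency `w` times the least ratio `g i / w i` makes one coefficient vanish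
  -- and keeps the others nonnegative.
  obtain ⟨k, hk⟩ := Finite.exists_min fun i => g i / w i
  obtain ⟨m, hm⟩ : ∃ m, m = g k / w k := ⟨_, rfl⟩
  have hge : ∀ i, 0 ≤ g i - m * w i := fun i => by
    have := hk i
    rw [← hm, le_div_iff₀ (hw i)] at this
    linarith
  have hk0 : g k - m * w k = 0 := by rw [hm, div_mul_cancel₀ _ (hw k).ne']; ring
  have e1 : p₁ = (g 0 - m * w 0) * a 0 + (g 1 - m * w 1) * a 1 + (g 2 - m * w 2) * a 2 := by
    rw [hg1]; linear_combination m * ha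
  have e2 : p₂ = (g 0 - m * w 0) * b 0 + (g 1 - m * w 1) * b 1 + (g 2 - m * w 2) * b 2 := by
    rw [hg2]; linear_combination m * hb
  refine ⟨k, fun i hi => ?_⟩
  obtain ⟨j, hj, hji⟩ : ∃ j, j ≠ k ∧ j ≠ i := by
    clear * -
    decide +revert
  refine ⟨j, g i - m * w i, g j - m * w j, hge i, hge j, ?_, ?_⟩
  · rw [e1, sum_three_eq (fun i => (g i - m * w i) * a i) hi hj hji, hk0]; ring
  · rw [e2, sum_three_eq (fun i => (g i - m * w i) * b i) hi hj hji, hk0]; ring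

theorem sq_add_sq_pos_of_inner_pos {a₁ a₂ v₁ v₂ : ℝ} (h : 0 < a₁ * v₁ + a₂ * v₂) :
    0 < v₁ ^ 2 + v₂ ^ 2 := by
  by_contra h'
  have h1 : v₁ = 0 := by nlinarith [sq_nonneg v₁, sq_nonneg v₂]
  have h2 : v₂ = 0 := by nlinarith [sq_nonneg v₁, sq_nonneg v₂]
  simp [h1, h2] at h

/-- The bound on the width from a diametral pair `p`, `q` and a point `x` beyond the incircle. -/
theorem width_le_of_tangent_cone {r W R D a₁ a₂ x₁ x₂ p₁ p₂ q₁ q₂ : ℝ} (hr : 0 < r)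
    (hW : 2 * r < W) (ha : a₁ ^ 2 + a₂ ^ 2 = 1) (hax : a₁ * x₁ + a₂ * x₂ ≤ r - W)
    (hp : -r ≤ a₁ * p₁ + a₂ * p₂) (hp' : a₁ * p₁ + a₂ * p₂ ≤ r)
    (hq : -r ≤ a₁ * q₁ + a₂ * q₂) (hq' : a₁ * q₁ + a₂ * q₂ ≤ r)
    (hpc : ∀ s, s ^ 2 = x₁ ^ 2 + x₂ ^ 2 - r ^ 2 →
      r * (x₁ * (p₁ - x₁) + x₂ * (p₂ - x₂)) + s * (x₁ * (p₂ - x₂) - x₂ * (p₁ - x₁)) ≤ 0)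
    (hqc : ∀ s, s ^ 2 = x₁ ^ 2 + x₂ ^ 2 - r ^ 2 →
      r * (x₁ * (q₁ - x₁) + x₂ * (q₂ - x₂)) + s * (x₁ * (q₂ - x₂) - x₂ * (q₁ - x₁)) ≤ 0)
    (hD : 0 < D) (hD2 : D ^ 2 = (p₁ - q₁) ^ 2 + (p₂ - q₂) ^ 2)
    (hpx : (p₁ - x₁) ^ 2 + (p₂ - x₂) ^ 2 ≤ D ^ 2) (hqx : (q₁ - x₁) ^ 2 + (q₂ - x₂) ^ 2 ≤ D ^ 2)
    (hDR : D ≤ 2 * R)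
    (hR : ∀ B : ℝ, (∀ c₁ c₂ ρ : ℝ, 0 ≤ ρ → (x₁ - c₁) ^ 2 + (x₂ - c₂) ^ 2 ≤ ρ ^ 2 →
      (p₁ - c₁) ^ 2 + (p₂ - c₂) ^ 2 ≤ ρ ^ 2 → (q₁ - c₁) ^ 2 + (q₂ - c₂) ^ 2 ≤ ρ ^ 2 → B ≤ ρ) →
      B ≤ R) :
    W ≤ 2 * r * (1 + 2 * r * R / D ^ 2 * (1 + √(1 - (D / (2 * R)) ^ 2))) := by
  obtain ⟨y, hy⟩ : ∃ y, y = -(a₁ * x₁ + a₂ * x₂) := ⟨_, rfl⟩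
  have hry : r < y := by linarith
  have hxy : (a₁ * x₂ - a₂ * x₁) ^ 2 + y ^ 2 = x₁ ^ 2 + x₂ ^ 2 := by
    rw [hy]; linear_combination (x₁ ^ 2 + x₂ ^ 2) * ha
  have hpos : 0 < x₁ ^ 2 + x₂ ^ 2 - r ^ 2 := by nlinarith [sq_nonneg (a₁ * x₂ - a₂ * x₁)]
  obtain ⟨s, hs, hs2⟩ : ∃ s, 0 < s ∧ s ^ 2 = x₁ ^ 2 + x₂ ^ 2 - r ^ 2 :=
    ⟨_, Real.sqrt_pos.2 hpos, Real.sq_sqrt hpos.le⟩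
  have hs2' : (-s) ^ 2 = x₁ ^ 2 + x₂ ^ 2 - r ^ 2 := by rw [neg_sq, hs2]
  have hp1 := hpc s hs2
  have hp2 := hpc (-s) hs2'
  have hq1 := hqc s hs2
  have hq2 := hqc (-s) hs2'
  rw [neg_mul, ← sub_eq_add_neg] at hp2 hq2
  obtain ⟨v₁, hv₁⟩ : ∃ v, v = p₁ - x₁ := ⟨_, rfl⟩
  obtain ⟨v₂, hv₂⟩ : ∃ v, v = p₂ - x₂ := ⟨_, rfl⟩
  obtain ⟨w₁, hw₁⟩ : ∃ v, v = q₁ - x₁ := ⟨_, rfl⟩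
  obtain ⟨w₂, hw₂⟩ : ∃ v, v = q₂ - x₂ := ⟨_, rfl⟩
  have e1 : p₁ - q₁ = v₁ - w₁ := by rw [hv₁, hw₁]; ring
  have e2 : p₂ - q₂ = v₂ - w₂ := by rw [hv₂, hw₂]; ring
  rw [e1, e2] at hD2
  rw [← hv₁, ← hv₂] at hp1 hp2 hpx
  rw [← hw₁, ← hw₂] at hq1 hq2 hqx
  rw [hD2] at hpx hqx
  have hvl : 2 * (v₁ * w₁ + v₂ * w₂) ≤ v₁ ^ 2 + v₂ ^ 2 := by linarith
  have hwl : 2 * (v₁ * w₁ + v₂ * w₂) ≤ w₁ ^ 2 + w₂ ^ 2 := by linarith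
  have hav : 0 < a₁ * v₁ + a₂ * v₂ := by rw [hv₁, hv₂]; linarith
  have haw : 0 < a₁ * w₁ + a₂ * w₂ := by rw [hw₁, hw₂]; linarith
  -- Coordinates are rotated so that `a` points straight down and `x` has height `y`.
  have rot_dot : ∀ z₁ z₂ z₃ z₄ : ℝ, (a₁ * z₂ - a₂ * z₁) * (a₁ * z₄ - a₂ * z₃) +
      -(a₁ * z₁ + a₂ * z₂) * -(a₁ * z₃ + a₂ * z₄) = z₁ * z₃ + z₂ * z₄ := by
    intro z₁ z₂ z₃ z₄; linear_combination (z₁ * z₃ + z₂ * z₄) * ha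
  have rot_cross : ∀ z₁ z₂ z₃ z₄ : ℝ, (a₁ * z₂ - a₂ * z₁) * -(a₁ * z₃ + a₂ * z₄) -
      -(a₁ * z₁ + a₂ * z₂) * (a₁ * z₄ - a₂ * z₃) = z₁ * z₄ - z₂ * z₃ := by
    intro z₁ z₂ z₃ z₄; linear_combination (z₁ * z₄ - z₂ * z₃) * ha
  have rot_sq : ∀ z₁ z₂ : ℝ, (a₁ * z₂ - a₂ * z₁) ^ 2 + (-(a₁ * z₁ + a₂ * z₂)) ^ 2 =
      z₁ ^ 2 + z₂ ^ 2 := by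
    intro z₁ z₂; linear_combination (z₁ ^ 2 + z₂ ^ 2) * ha
  have hbase := longest_side_le_base (r := r) (s := s) (x₁ := a₁ * x₂ - a₂ * x₁)
    (x₂ := -(a₁ * x₁ + a₂ * x₂)) (v₁ := a₁ * v₂ - a₂ * v₁) (v₂ := -(a₁ * v₁ + a₂ * v₂))
    (w₁ := a₁ * w₂ - a₂ * w₁) (w₂ := -(a₁ * w₁ + a₂ * w₂)) hr hs
    (by rw [rot_sq]; exact hs2) (by linarith) (by linarith) (by linarith)
    (by rw [hv₁, hv₂]; linarith) (by rw [hw₁, hw₂]; linarith)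
    (by rw [rot_dot, rot_cross]; exact hp1) (by rw [rot_dot, rot_cross]; exact hp2)
    (by rw [rot_dot, rot_cross]; exact hq1) (by rw [rot_dot, rot_cross]; exact hq2)
    (by rw [rot_dot, rot_sq]; exact hvl) (by rw [rot_dot, rot_sq]; exact hwl)
  have e3 : (a₁ * v₂ - a₂ * v₁ - (a₁ * w₂ - a₂ * w₁)) ^ 2 +
      (-(a₁ * v₁ + a₂ * v₂) - -(a₁ * w₁ + a₂ * w₂)) ^ 2 = D ^ 2 := by
    rw [hD2]; linear_combination ((v₁ - w₁) ^ 2 + (v₂ - w₂) ^ 2) * ha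
  rw [e3, ← mul_pow] at hbase
  have hDt : D * (-(a₁ * x₁ + a₂ * x₂) - r) ≤ 2 * r * s :=
    le_of_sq_le_sq hbase (by positivity)
  have hDt' : D * (W - 2 * r) ≤ 2 * r * s :=
    (mul_le_mul_of_nonneg_left (by linarith) hD.le).trans hDt
  have hfin := le_upper_bound_of_radii hr hs hD hDR hDt' fun hrs => ?_
  · linarith
  · have hpos4 : 0 < 4 * r * s := by positivity
    rw [← div_le_iff₀' hpos4]
    -- `R` is an infimum, so the estimate is proved for the radius `ρ` of every disc containing the
    -- three points; no smallest disc is needed.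
    refine hR _ fun c₁ c₂ ρ hρ h0 h1 h2 => ?_
    rw [div_le_iff₀' hpos4]
    refine circumradius_lower_bound (c₁ := c₁ - x₁) (c₂ := c₂ - x₂) hr hrs hs2 hρ hD2
      ?_ ?_ hp1 hp2 hq1 hq2 hvl hwl (by linarith)
      (by rw [hv₁, hv₂]; linarith) (by rw [hw₁, hw₂]; linarith)
    · exact sq_add_sq_pos_of_inner_pos hav
    · exact sq_add_sq_pos_of_inner_pos haw

/-! ### From convex bodies to coordinates: the inequality -/

theorem plane_inner (u v : Plane) : inner ℝ u v = u 0 * v 0 + u 1 * v 1 := by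
  simp [PiLp.inner_apply, Fin.sum_univ_two, mul_comm]

theorem plane_norm_sq (u : Plane) : ‖u‖ ^ 2 = u 0 ^ 2 + u 1 ^ 2 := by
  simp [EuclideanSpace.norm_sq_eq, Fin.sum_univ_two]

theorem plane_dist_sq (u v : Plane) : dist u v ^ 2 = (u 0 - v 0) ^ 2 + (u 1 - v 1) ^ 2 := by
  rw [dist_eq_norm, plane_norm_sq]; simp

theorem isCompact_image_inner {K : Set Plane} (hK : IsCompact K) (u : Plane) :
    IsCompact ((fun x => inner ℝ u x) '' K) :=
  hK.image (by fun_prop)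

theorem inner_sub_le_breadth {K : Set Plane} (hK : IsCompact K) (u : Plane) {x y : Plane}
    (hx : x ∈ K) (hy : y ∈ K) : inner ℝ u (x - y) ≤ breadth K u := by
  have h1 := le_csSup (isCompact_image_inner hK u).bddAbove (Set.mem_image_of_mem _ hx)
  have h2 := csInf_le (isCompact_image_inner hK u).bddBelow (Set.mem_image_of_mem _ hy)
  rw [inner_sub_right, breadth]
  linarith

theorem width_le_breadth {K : Set Plane} (hK : IsCompact K) (hne : K.Nonempty) {u : Plane}
    (hu : ‖u‖ = 1) : width K ≤ breadth K u := by
  refine csInf_le ⟨0, ?_⟩ ⟨u, by simpa using hu, rfl⟩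
  rintro _ ⟨v, -, rfl⟩
  obtain ⟨x, hx⟩ := hne
  simpa using inner_sub_le_breadth hK v hx hx

/-- `K` reaches at least as far as its width from each of its supporting lines. -/
theorem exists_mem_inner_le_sub_width {K : Set Plane} (hK : IsCompact K) (hne : K.Nonempty)
    {c u : Plane} {r : ℝ} (hu : u ∈ contactNormals K c r) :
    ∃ x ∈ K, inner ℝ u (x - c) ≤ r - width K := by
  obtain ⟨x, hx, hmin⟩ := hK.exists_isMinOn hne
    (f := fun x => inner ℝ u x) (by fun_prop)
  refine ⟨x, hx, ?_⟩
  have h1 := width_le_breadth hK hne hu.1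
  have h2 : sSup ((fun x => inner ℝ u x) '' K) ≤ r + inner ℝ u c := by
    refine csSup_le (hne.image _) ?_
    rintro _ ⟨z, hz, rfl⟩
    have := hu.2 z hz
    rw [inner_sub_right] at this
    dsimp only
    linarith
  have h3 : inner ℝ u x ≤ sInf ((fun x => inner ℝ u x) '' K) := by
    refine le_csInf (hne.image _) ?_
    rintro _ ⟨z, hz, rfl⟩
    exact hmin hz
  rw [breadth] at h1
  rw [inner_sub_right]
  linarith

theorem bddBelow_circumradius (K : Set Plane) :
    BddBelow {ρ : ℝ | 0 ≤ ρ ∧ ∃ c : Plane, K ⊆ Metric.closedBall c ρ} :=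
  ⟨0, fun _ h => h.1⟩

theorem le_circumradius {K : Set Plane} (hK : IsCompact K) {B : ℝ}
    (h : ∀ (ρ : ℝ) (c : Plane), 0 ≤ ρ → K ⊆ Metric.closedBall c ρ → B ≤ ρ) :
    B ≤ circumradius K := by
  refine le_csInf ?_ fun ρ ⟨hρ, c, hc⟩ => h ρ c hρ hc
  obtain ⟨ρ, hρ⟩ := hK.isBounded.subset_closedBall (0 : Plane)
  exact ⟨max ρ 0, le_max_right _ _, 0,
    hρ.trans (Metric.closedBall_subset_closedBall (le_max_left _ _))⟩

theorem circumradius_nonneg (K : Set Plane) : 0 ≤ circumradius K :=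
  Real.sInf_nonneg fun _ h => h.1

theorem exists_diametral_pair (K : ConvexBody Plane) :
    ∃ p ∈ (K : Set Plane), ∃ q ∈ (K : Set Plane), dist p q = diameter K := by
  obtain ⟨⟨p, q⟩, ⟨hp, hq⟩, hmax⟩ := (K.isCompact.prod K.isCompact).exists_isMaxOn
    (K.nonempty.prod K.nonempty) (f := fun z : Plane × Plane => dist z.1 z.2) (by fun_prop)
  refine ⟨p, hp, q, hq, le_antisymm
    (Metric.dist_le_diam_of_mem K.isCompact.isBounded hp hq) ?_⟩
  refine Metric.diam_le_of_forall_dist_le dist_nonneg fun a ha b hb => ?_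
  have h := isMaxOn_iff.1 hmax (a, b) (Set.mk_mem_prod ha hb)
  exact h

/-- Pairing `∑ w i • u i = 0` with `x k - c` gives zero as a weighted sum of terms at most `r`, the
`k`-th being at most `r - W`. -/
theorem weight_mul_width_le {K : Set Plane} {c : Plane} {r W : ℝ} {w : Fin 3 → ℝ}
    {u x : Fin 3 → Plane} (hw : ∀ i, 0 ≤ w i) (hw1 : ∑ i, w i = 1)
    (hu : ∀ i, ∀ z ∈ K, inner ℝ (u i) (z - c) ≤ r) (hwu : ∑ i, w i • u i = 0)
    (hxK : ∀ i, x i ∈ K) (hx : ∀ i, inner ℝ (u i) (x i - c) ≤ r - W) (k : Fin 3) :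
    w k * W ≤ r := by
  have h1 : ∑ i, w i * inner ℝ (u i) (x k - c) = 0 := by
    rw [← inner_zero_left (x k - c), ← hwu, sum_inner]
    simp only [real_inner_smul_left]
  have h2 : ∑ i, w i * inner ℝ (u i) (x k - c) ≤ ∑ i, w i * (r - if i = k then W else 0) := by
    refine Finset.sum_le_sum fun i _ => mul_le_mul_of_nonneg_left ?_ (hw i)
    split_ifs with h
    · rw [h]; exact hx k
    · rw [sub_zero]; exact hu i _ (hxK k)
  rw [h1] at h2
  simp only [mul_sub, Finset.sum_sub_distrib, ← Finset.sum_mul, hw1, mul_ite, mul_zero,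
    Finset.sum_ite_eq', Finset.mem_univ, if_true] at h2
  linarith

theorem width_le_upperBound (K : ConvexBody Plane) (hK : (K : Set Plane).Nontrivial) :
    width K ≤ upperBound K := by
  obtain ⟨c, hcK, hr0, hball, hmax⟩ := exists_incircle K
  rw [upperBound]
  rcases le_or_gt (width (K : Set Plane)) (2 * inradius K) with hW | hW
  · refine hW.trans (le_mul_of_one_le_right (by positivity) ?_)
    have := circumradius_nonneg (K : Set Plane)
    have : 0 ≤ 2 * inradius K * circumradius K / diameter K ^ 2 *
      (1 + √(1 - (diameter K / (2 * circumradius K)) ^ 2)) := by positivity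
    linarith
  obtain ⟨w, u, hw, hw1, hu, hwu⟩ := exists_contactNormals_sum_eq_zero K hr0 hball hmax
  have hx : ∀ i, ∃ x ∈ (K : Set Plane), inner ℝ (u i) (x - c) ≤ inradius K - width K := fun i =>
    exists_mem_inner_le_sub_width K.isCompact K.nonempty (hu i)
  choose x hxK hx using hx
  set r := inradius (K : Set Plane) with hr
  set W := width (K : Set Plane) with hWdef
  have hwW := weight_mul_width_le hw hw1 (fun i z hz => (hu i).2 z hz) hwu hxK hx
  have hWpos : 0 < W := by linarith
  have hrpos : 0 < r := by
    rcases hr0.lt_or_eq with h | h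
    · exact h
    · have : ∑ i, w i ≤ 0 := Finset.sum_nonpos fun i _ => by
        have := hwW i
        rw [← h] at this
        exact nonpos_of_mul_nonpos_left this hWpos
      linarith
  have hw' : ∀ i, w i < 1 / 2 := fun i => by
    have := hwW i
    by_contra h
    linarith [mul_le_mul_of_nonneg_right (not_lt.1 h) hWpos.le]
  have hwpos : ∀ i, 0 < w i := by
    intro i
    rw [Fin.sum_univ_three] at hw1
    fin_cases i <;> simp <;> linarith [hw' 0, hw' 1, hw' 2]
  have hunit : ∀ i, u i 0 ^ 2 + u i 1 ^ 2 = 1 := fun i => by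
    rw [← plane_norm_sq, (hu i).1, one_pow]
  have hsum : ∀ j, ∑ i, w i * u i j = 0 := fun j => by
    have := congrArg (fun z : Plane => z j) hwu
    simpa [Fin.sum_univ_three] using this
  obtain ⟨p, hp, q, hq, hpq⟩ := exists_diametral_pair K
  have hdist : ∀ a ∈ (K : Set Plane), ∀ b ∈ (K : Set Plane), dist a b ≤ diameter K :=
    fun a ha b hb => Metric.dist_le_diam_of_mem K.isCompact.isBounded ha hb
  have hD : 0 < diameter (K : Set Plane) := by
    obtain ⟨a, ha, b, hb, hab⟩ := hK
    exact (dist_pos.2 hab).trans_le (hdist a ha b hb)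
  obtain ⟨k, hk⟩ := exists_label hunit hwpos hw' hw1 (hsum 0) (hsum 1) ((p - c) 0) ((p - c) 1)
  obtain ⟨l, hl⟩ := exists_label hunit hwpos hw' hw1 (hsum 0) (hsum 1) ((q - c) 0) ((q - c) 1)
  -- `p` and `q` each exclude one of three indices, so one remains.
  obtain ⟨i, hik, hil⟩ : ∃ i, i ≠ k ∧ i ≠ l := by
    clear * -
    decide +revert
  have hle : ∀ j, ∀ z ∈ (K : Set Plane), u j 0 * (z - c) 0 + u j 1 * (z - c) 1 ≤ r :=
    fun j z hz => by rw [← plane_inner]; exact (hu j).2 z hz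
  have hxi := hx i
  rw [plane_inner] at hxi
  have hL : 0 < (x i - c) 0 ^ 2 + (x i - c) 1 ^ 2 := by
    rw [← plane_norm_sq]
    refine pow_pos (norm_pos_iff.2 fun h => ?_) 2
    simp only [h] at hxi
    simp at hxi
    linarith
  obtain ⟨j, α, β, hα, hβ, hp0, hp1⟩ := hk i hik
  obtain ⟨j', α', β', hα', hβ', hq0, hq1⟩ := hl i hil
  refine width_le_of_tangent_cone hrpos hW (hunit i) hxi
    (neg_le_inner_of_mem_cone (hunit i) (hunit j) hα hβ hp0 hp1 (hle j p hp)) (hle i p hp)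
    (neg_le_inner_of_mem_cone (hunit i) (hunit j') hα' hβ' hq0 hq1 (hle j' q hq)) (hle i q hq)
    (fun s hs => mem_tangent_cone hr0 (hunit i) (hunit j) hL hs (by linarith)
      (hle j _ (hxK i)) hα hβ hp0 hp1 (hle i p hp) (hle j p hp))
    (fun s hs => mem_tangent_cone hr0 (hunit i) (hunit j') hL hs (by linarith)
      (hle j' _ (hxK i)) hα' hβ' hq0 hq1 (hle i q hq) (hle j' q hq))
    hD ?_ ?_ ?_ ?_ ?_
  · rw [← hpq, plane_dist_sq]; simp
  · have := pow_le_pow_left₀ dist_nonneg (hdist p hp (x i) (hxK i)) 2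
    rw [plane_dist_sq] at this
    simpa using this
  · have := pow_le_pow_left₀ dist_nonneg (hdist q hq (x i) (hxK i)) 2
    rw [plane_dist_sq] at this
    simpa using this
  · rw [← div_le_iff₀' two_pos]
    refine le_circumradius K.isCompact fun ρ d hρ hd => ?_
    rw [div_le_iff₀' two_pos, ← hpq]
    have := dist_triangle_right p q d
    linarith [Metric.mem_closedBall.1 (hd hp), Metric.mem_closedBall.1 (hd hq)]
  · intro B hB
    refine le_circumradius K.isCompact fun ρ d hρ hd => ?_
    have hmem : ∀ z ∈ (K : Set Plane), ((z - c) 0 - (d - c) 0) ^ 2 + ((z - c) 1 - (d - c) 1) ^ 2 ≤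
        ρ ^ 2 := fun z hz => by
      have := pow_le_pow_left₀ dist_nonneg (Metric.mem_closedBall.1 (hd hz)) 2
      rw [plane_dist_sq] at this
      simpa using this
    exact hB _ _ ρ hρ (hmem _ (hxK i)) (hmem p hp) (hmem q hq)

/-! ### Radii of triangles: equality -/

/-- Twice the signed area of a triangle. -/
def doubleArea (A B C : Plane) : ℝ :=
  (B 0 - A 0) * (C 1 - A 1) - (B 1 - A 1) * (C 0 - A 0)

theorem doubleArea_swap (A B C : Plane) : doubleArea A C B = -doubleArea A B C := by
  simp only [doubleArea]; ring

theorem doubleArea_rotate (A B C : Plane) : doubleArea B C A = doubleArea A B C := by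
  simp only [doubleArea]; ring

/-- The line through the middle vertex orthogonal to `u` cuts the triangle in a chord no longer than
`l`, and the doubled area is the breadth times that chord. The vector `h • (Q - P) - g • (R - P)` in
the proof is this chord times the breadth. -/
theorem abs_doubleArea_le_of_sorted {u P Q R : Plane} {l : ℝ} (hu : ‖u‖ = 1)
    (hPQ : inner ℝ u P ≤ inner ℝ u Q) (hQR : inner ℝ u Q ≤ inner ℝ u R)
    (hl : dist Q P ≤ l) (hl' : dist Q R ≤ l) :
    |doubleArea P Q R| ≤ inner ℝ u (R - P) * l := by
  obtain ⟨g, hg⟩ : ∃ g, g = inner ℝ u (Q - P) := ⟨_, rfl⟩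
  obtain ⟨h, hh⟩ : ∃ h, h = inner ℝ u (R - P) := ⟨_, rfl⟩
  have g0 : 0 ≤ g := by rw [hg, inner_sub_right]; linarith
  have gh : 0 ≤ h - g := by rw [hg, hh, inner_sub_right, inner_sub_right]; linarith
  have hu2 : u 0 ^ 2 + u 1 ^ 2 = 1 := by rw [← plane_norm_sq, hu, one_pow]
  have e1 : ‖h • (Q - P) - g • (R - P)‖ = |doubleArea P Q R| := by
    rw [← sq_eq_sq₀ (norm_nonneg _) (abs_nonneg _), sq_abs, plane_norm_sq, hg, hh, plane_inner,
      plane_inner]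
    simp only [PiLp.sub_apply, PiLp.smul_apply, smul_eq_mul, doubleArea]
    linear_combination
      ((Q 0 - P 0) * (R 1 - P 1) - (Q 1 - P 1) * (R 0 - P 0)) ^ 2 * hu2
  have e2 : h • (Q - P) - g • (R - P) = (h - g) • (Q - P) + g • (Q - R) := by module
  rw [← e1, e2, ← hh]
  refine (norm_add_le _ _).trans ?_
  rw [norm_smul, norm_smul, Real.norm_of_nonneg gh, Real.norm_of_nonneg g0, ← dist_eq_norm,
    ← dist_eq_norm]
  have k1 := mul_le_mul_of_nonneg_left hl gh
  have k2 := mul_le_mul_of_nonneg_left hl' g0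
  linarith

theorem exists_abs_doubleArea_le {u A B C : Plane} {l : ℝ} (hu : ‖u‖ = 1)
    (hAB : dist A B ≤ l) (hBC : dist B C ≤ l) (hCA : dist C A ≤ l) :
    ∃ x ∈ ({A, B, C} : Set Plane), ∃ y ∈ ({A, B, C} : Set Plane),
      |doubleArea A B C| ≤ inner ℝ u (x - y) * l := by
  have hAB' : dist B A ≤ l := dist_comm A B ▸ hAB
  have hBC' : dist C B ≤ l := dist_comm B C ▸ hBC
  have hCA' : dist A C ≤ l := dist_comm C A ▸ hCA
  have s1 : |doubleArea A C B| = |doubleArea A B C| := by rw [doubleArea_swap, abs_neg]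
  have s2 : |doubleArea B C A| = |doubleArea A B C| := by rw [doubleArea_rotate]
  have s3 : |doubleArea B A C| = |doubleArea A B C| := by rw [doubleArea_swap, abs_neg, s2]
  have s4 : |doubleArea C A B| = |doubleArea A B C| := by rw [doubleArea_rotate, s2]
  have s5 : |doubleArea C B A| = |doubleArea A B C| := by rw [doubleArea_swap, abs_neg, s4]
  rcases le_total (inner ℝ u A) (inner ℝ u B) with h1 | h1 <;>
  rcases le_total (inner ℝ u B) (inner ℝ u C) with h2 | h2 <;>
  rcases le_total (inner ℝ u A) (inner ℝ u C) with h3 | h3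
  · exact ⟨C, by simp, A, by simp, abs_doubleArea_le_of_sorted hu h1 h2 hAB' hBC⟩
  · exact ⟨C, by simp, A, by simp, abs_doubleArea_le_of_sorted hu h1 h2 hAB' hBC⟩
  · exact ⟨B, by simp, A, by simp, s1 ▸ abs_doubleArea_le_of_sorted hu h3 h2 hCA hBC'⟩
  · exact ⟨B, by simp, C, by simp, s4 ▸ abs_doubleArea_le_of_sorted hu h3 h1 hCA' hAB⟩
  · exact ⟨C, by simp, B, by simp, s3 ▸ abs_doubleArea_le_of_sorted hu h1 h3 hAB hCA'⟩
  · exact ⟨A, by simp, B, by simp, s2 ▸ abs_doubleArea_le_of_sorted hu h2 h3 hBC' hCA⟩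
  · exact ⟨A, by simp, C, by simp, s5 ▸ abs_doubleArea_le_of_sorted hu h2 h1 hBC hAB'⟩
  · exact ⟨A, by simp, C, by simp, s5 ▸ abs_doubleArea_le_of_sorted hu h2 h1 hBC hAB'⟩

theorem isCompact_convexHull_triple (A B C : Plane) :
    IsCompact (convexHull ℝ ({A, B, C} : Set Plane)) :=
  Set.Finite.isCompact_convexHull ℝ (Set.toFinite _)

theorem abs_doubleArea_le_width_mul {A B C : Plane} {l : ℝ} (h0 : 0 < l)
    (hAB : dist A B ≤ l) (hBC : dist B C ≤ l) (hCA : dist C A ≤ l) :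
    |doubleArea A B C| / l ≤ width (convexHull ℝ {A, B, C}) := by
  have hne : (Metric.sphere (0 : Plane) 1).Nonempty := NormedSpace.sphere_nonempty.2 zero_le_one
  refine le_csInf (hne.image _) ?_
  rintro _ ⟨u, hu, rfl⟩
  obtain ⟨x, hx, y, hy, hxy⟩ := exists_abs_doubleArea_le (by simpa using hu) hAB hBC hCA
  rw [div_le_iff₀ h0]
  refine hxy.trans (mul_le_mul_of_nonneg_right ?_ h0.le)
  exact inner_sub_le_breadth (isCompact_convexHull_triple A B C) u (subset_convexHull ℝ _ hx)
    (subset_convexHull ℝ _ hy)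

theorem add_mul_norm_le_of_closedBall_subset {K : Set Plane} {n z : Plane} {b ρ : ℝ}
    (hρ : 0 ≤ ρ) (hb : ∀ y ∈ K, b ≤ inner ℝ n y) (hball : Metric.closedBall z ρ ⊆ K) :
    b + ρ * ‖n‖ ≤ inner ℝ n z := by
  rcases eq_or_ne n 0 with rfl | hn
  · simpa using hb z (hball (Metric.mem_closedBall_self hρ))
  · have hn' : ‖n‖ ≠ 0 := norm_ne_zero_iff.2 hn
    have := hb (z - (ρ / ‖n‖) • n) (hball (by
      simp [norm_smul, abs_of_nonneg hρ, hn]))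
    rw [inner_sub_right, real_inner_smul_right, real_inner_self_eq_norm_sq] at this
    have e : ρ / ‖n‖ * ‖n‖ ^ 2 = ρ * ‖n‖ := by field_simp
    linarith

theorem le_inner_of_mem_convexHull {s : Set Plane} {n : Plane} {b : ℝ}
    (h : ∀ y ∈ s, b ≤ inner ℝ n y) : ∀ y ∈ convexHull ℝ s, b ≤ inner ℝ n y := by
  have hc : Convex ℝ {y : Plane | b ≤ inner ℝ n y} :=
    convex_halfSpace_ge (innerₗ Plane n).isLinear b
  exact fun y hy => convexHull_min (t := {y : Plane | b ≤ inner ℝ n y}) h hc hy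

theorem inradius_nonneg (K : Set Plane) : 0 ≤ inradius K :=
  Real.sSup_nonneg fun _ h => h.1

/-- A point of a disc in a triangle is at distance at least the radius from each side. -/
theorem radius_mul_dist_le {A B C z : Plane} {ρ : ℝ} (hρ : 0 ≤ ρ)
    (hball : Metric.closedBall z ρ ⊆ convexHull ℝ {A, B, C}) :
    ρ * (|doubleArea A B C| * dist A B) ≤ doubleArea A B C * doubleArea A B z := by
  obtain ⟨S, hS⟩ : ∃ S, S = doubleArea A B C := ⟨_, rfl⟩
  -- The factor `S` turns the normal of `AB` inward for either orientation of the triangle.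
  obtain ⟨n, hn⟩ : ∃ n : Plane, n = S • !₂[-(B 1 - A 1), B 0 - A 0] := ⟨_, rfl⟩
  have hin : ∀ y, inner ℝ n y - inner ℝ n A = S * doubleArea A B y := fun y => by
    rw [hn, plane_inner, plane_inner]; simp [doubleArea]; ring
  have hnorm : ‖n‖ = |S| * dist A B := by
    rw [← sq_eq_sq₀ (norm_nonneg _) (by positivity), mul_pow, sq_abs, plane_dist_sq,
      plane_norm_sq, hn]
    simp; ring
  have h : ∀ y ∈ ({A, B, C} : Set Plane), inner ℝ n A ≤ inner ℝ n y := by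
    intro y hy
    have := hin y
    rcases hy with rfl | rfl | rfl
    · rfl
    · have e : doubleArea A y y = 0 := by simp only [doubleArea]; ring
      rw [e] at this; linarith
    · rw [← hS] at this; nlinarith
  have := add_mul_norm_le_of_closedBall_subset hρ (le_inner_of_mem_convexHull h) hball
  rw [hnorm] at this
  rw [← hS]
  linarith [hin z]

/-- The triangles over the three sides with apex at the centre of a contained disc have signed areas
adding up to the whole, and each has height at least the radius. -/
theorem inradius_le_of_triangle {A B C : Plane} (hS : doubleArea A B C ≠ 0) :
    inradius (convexHull ℝ {A, B, C}) * (dist A B + dist B C + dist C A) ≤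
      |doubleArea A B C| := by
  have hS0 : 0 < |doubleArea A B C| := abs_pos.2 hS
  have hAB : 0 < dist A B := dist_pos.2 fun h => hS (by rw [h]; simp only [doubleArea]; ring)
  have hp : 0 < dist A B + dist B C + dist C A := by positivity
  rw [← le_div_iff₀ hp]
  refine csSup_le ⟨0, le_rfl, A, ?_⟩ ?_
  · rw [Metric.closedBall_zero]
    exact Set.singleton_subset_iff.2 (subset_convexHull ℝ _ (by simp))
  · rintro ρ ⟨hρ, z, hz⟩
    rw [le_div_iff₀ hp]
    have h1 := radius_mul_dist_le hρ hz
    have p1 : ({B, C, A} : Set Plane) = {A, B, C} := by ext; simp; tauto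
    have p2 : ({C, A, B} : Set Plane) = {A, B, C} := by ext; simp; tauto
    have h2 := radius_mul_dist_le (A := B) (B := C) (C := A) hρ (by rw [p1]; exact hz)
    have h3 := radius_mul_dist_le (A := C) (B := A) (C := B) hρ (by rw [p2]; exact hz)
    rw [doubleArea_rotate] at h2
    rw [doubleArea_rotate, doubleArea_rotate] at h3
    have e : doubleArea A B z + doubleArea B C z + doubleArea C A z = doubleArea A B C := by
      simp only [doubleArea]; ring
    refine le_of_mul_le_mul_left ?_ hS0
    have e2 : |doubleArea A B C| * |doubleArea A B C| =
        doubleArea A B C * doubleArea A B z + doubleArea A B C * doubleArea B C z +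
          doubleArea A B C * doubleArea C A z := by
      rw [abs_mul_abs_self, ← mul_add, ← mul_add, e]
    rw [e2]
    linarith

/-- The circumcentre of a triangle, by coordinates. -/
theorem exists_circumcentre {A B C : Plane} (hS : doubleArea A B C ≠ 0) :
    ∃ o : Plane, ∀ z ∈ ({A, B, C} : Set Plane),
      dist z o = dist A B * dist B C * dist C A / (2 * |doubleArea A B C|) := by
  obtain ⟨v₁, hv₁⟩ : ∃ v, v = B 0 - A 0 := ⟨_, rfl⟩
  obtain ⟨v₂, hv₂⟩ : ∃ v, v = B 1 - A 1 := ⟨_, rfl⟩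
  obtain ⟨w₁, hw₁⟩ : ∃ v, v = C 0 - A 0 := ⟨_, rfl⟩
  obtain ⟨w₂, hw₂⟩ : ∃ v, v = C 1 - A 1 := ⟨_, rfl⟩
  have hB0 : B 0 = A 0 + v₁ := by rw [hv₁]; ring
  have hB1 : B 1 = A 1 + v₂ := by rw [hv₂]; ring
  have hC0 : C 0 = A 0 + w₁ := by rw [hw₁]; ring
  have hC1 : C 1 = A 1 + w₂ := by rw [hw₂]; ring
  have hSe : doubleArea A B C = v₁ * w₂ - v₂ * w₁ := by rw [doubleArea, hv₁, hv₂, hw₁, hw₂]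
  obtain ⟨S, hSd⟩ : ∃ S, S = v₁ * w₂ - v₂ * w₁ := ⟨_, rfl⟩
  have hS' : S ≠ 0 := by rwa [hSd, ← hSe]
  refine ⟨!₂[A 0 + ((v₁ ^ 2 + v₂ ^ 2) * w₂ - (w₁ ^ 2 + w₂ ^ 2) * v₂) / (2 * S),
    A 1 + ((w₁ ^ 2 + w₂ ^ 2) * v₁ - (v₁ ^ 2 + v₂ ^ 2) * w₁) / (2 * S)], fun z hz => ?_⟩
  have hS0 : 0 < |doubleArea A B C| := abs_pos.2 hS
  rw [← sq_eq_sq₀ dist_nonneg (by positivity), div_pow, mul_pow, mul_pow, mul_pow, sq_abs,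
    plane_dist_sq, plane_dist_sq, plane_dist_sq, plane_dist_sq, hSe, ← hSd]
  rcases hz with rfl | rfl | rfl
  · simp only [hB0, hB1, hC0, hC1, Matrix.cons_val_zero, Matrix.cons_val_one]
    field_simp
    rw [hSd]; ring
  · simp only [hB0, hB1, hC0, hC1, Matrix.cons_val_zero, Matrix.cons_val_one]
    field_simp
    rw [hSd]; ring
  · simp only [hB0, hB1, hC0, hC1, Matrix.cons_val_zero, Matrix.cons_val_one]
    field_simp
    rw [hSd]; ring

theorem le_circumradius_of_nonobtuse {A B C : Plane} (hS : doubleArea A B C ≠ 0)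
    (hA : 0 ≤ inner ℝ (B - A) (C - A)) (hB : 0 ≤ inner ℝ (A - B) (C - B))
    (hC : 0 ≤ inner ℝ (A - C) (B - C)) :
    dist A B * dist B C * dist C A / (2 * |doubleArea A B C|) ≤
      circumradius (convexHull ℝ {A, B, C}) := by
  refine le_circumradius (isCompact_convexHull_triple A B C) fun ρ c hρ hc => ?_
  have hmem : ∀ z ∈ ({A, B, C} : Set Plane), (z 0 - c 0) ^ 2 + (z 1 - c 1) ^ 2 ≤ ρ ^ 2 := by
    intro z hz
    rw [← plane_dist_sq]
    exact pow_le_pow_left₀ dist_nonneg (hc (subset_convexHull ℝ _ hz)) 2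
  have hS0 : 0 < |doubleArea A B C| := abs_pos.2 hS
  rw [div_le_iff₀ (by positivity)]
  refine le_of_sq_le_sq ?_ (by positivity)
  rw [plane_inner] at hA hB hC
  simp only [PiLp.sub_apply] at hA hB hC
  have := circumradius_le_of_nonobtuse (v₁ := B 0 - A 0) (v₂ := B 1 - A 1) (w₁ := C 0 - A 0)
    (w₂ := C 1 - A 1) (c₁ := c 0 - A 0) (c₂ := c 1 - A 1) (R := ρ) hA (by linarith) (by linarith)
    (by linarith [hmem A (by simp)]) (by linarith [hmem B (by simp)])
    (by linarith [hmem C (by simp)]) hS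
  have e : (dist A B * dist B C * dist C A) ^ 2 =
      ((B 0 - A 0) ^ 2 + (B 1 - A 1) ^ 2) * ((C 0 - A 0) ^ 2 + (C 1 - A 1) ^ 2) *
      ((B 0 - A 0 - (C 0 - A 0)) ^ 2 + (B 1 - A 1 - (C 1 - A 1)) ^ 2) := by
    rw [mul_pow, mul_pow, plane_dist_sq, plane_dist_sq, plane_dist_sq]; ring
  rw [e, mul_pow, mul_pow, sq_abs]
  refine this.trans_eq ?_
  rw [doubleArea]; ring

theorem circumradius_eq_of_nonobtuse {A B C : Plane} (hS : doubleArea A B C ≠ 0)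
    (hA : 0 ≤ inner ℝ (B - A) (C - A)) (hB : 0 ≤ inner ℝ (A - B) (C - B))
    (hC : 0 ≤ inner ℝ (A - C) (B - C)) :
    circumradius (convexHull ℝ {A, B, C}) =
        dist A B * dist B C * dist C A / (2 * |doubleArea A B C|) ∧
      ∃ o : Plane,
        convexHull ℝ {A, B, C} ⊆ Metric.closedBall o (circumradius (convexHull ℝ {A, B, C})) ∧
        ∀ z ∈ ({A, B, C} : Set Plane), z ∈ Metric.sphere o (circumradius (convexHull ℝ {A, B, C})) := by
  obtain ⟨o, ho⟩ := exists_circumcentre hS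
  have hsub : convexHull ℝ {A, B, C} ⊆ Metric.closedBall o
      (dist A B * dist B C * dist C A / (2 * |doubleArea A B C|)) :=
    convexHull_min (fun z hz => Metric.mem_closedBall.2 (ho z hz).le) (convex_closedBall _ _)
  have heq : circumradius (convexHull ℝ {A, B, C}) =
      dist A B * dist B C * dist C A / (2 * |doubleArea A B C|) :=
    le_antisymm (csInf_le (bddBelow_circumradius _) ⟨by positivity, o, hsub⟩)
      (le_circumradius_of_nonobtuse hS hA hB hC)
  exact ⟨heq, o, heq ▸ hsub, fun z hz => by rw [heq]; exact ho z hz⟩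

/-- The bound is at most the altitude on the longest side. -/
theorem upper_bound_le_altitude {a b c r R D S : ℝ} (ha : 0 < a) (hb : 0 < b) (hc : 0 < c)
    (hS : 0 < S) (hr : 0 ≤ r) (hrS : r * (c + a + b) ≤ S) (hR : R = c * a * b / (2 * S))
    (hcD : c ≤ D) (hdot : 0 ≤ a ^ 2 + b ^ 2 - c ^ 2)
    (hheron : 4 * S ^ 2 = 4 * a ^ 2 * b ^ 2 - (a ^ 2 + b ^ 2 - c ^ 2) ^ 2) :
    2 * r * (1 + 2 * r * R / D ^ 2 * (1 + √(1 - (D / (2 * R)) ^ 2))) ≤ S / c := by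
  have hR0 : 0 < R := by rw [hR]; positivity
  -- The right-hand side is the cosine of the angle opposite `c`; by the law of sines its sine is `c
  -- / (2R) ≤ D / (2R)`.
  have hsqrt : √(1 - (D / (2 * R)) ^ 2) ≤ (a ^ 2 + b ^ 2 - c ^ 2) / (2 * a * b) := by
    refine Real.sqrt_le_iff.2 ⟨by positivity, ?_⟩
    have h1 : (c / (2 * R)) ^ 2 ≤ (D / (2 * R)) ^ 2 := by gcongr
    have h2 : (c / (2 * R)) ^ 2 = 1 - ((a ^ 2 + b ^ 2 - c ^ 2) / (2 * a * b)) ^ 2 := by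
      rw [hR]; field_simp; linarith
    linarith
  have hrR : 2 * r * R ≤ a * b * c / (c + a + b) := by
    rw [hR, le_div_iff₀ (by positivity)]
    have e : 2 * r * (c * a * b / (2 * S)) * (c + a + b) = (r * (c + a + b)) * (a * b * c / S) := by
      field_simp
    rw [e]
    calc r * (c + a + b) * (a * b * c / S) ≤ S * (a * b * c / S) := by gcongr
      _ = a * b * c := by field_simp
  have hquot : 2 * r * R / D ^ 2 ≤ a * b * c / (c + a + b) / c ^ 2 := by gcongr
  have hprod : 2 * r * R / D ^ 2 * (1 + √(1 - (D / (2 * R)) ^ 2)) ≤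
      a * b * c / (c + a + b) / c ^ 2 * (1 + (a ^ 2 + b ^ 2 - c ^ 2) / (2 * a * b)) := by gcongr
  have e : a * b * c / (c + a + b) / c ^ 2 * (1 + (a ^ 2 + b ^ 2 - c ^ 2) / (2 * a * b)) =
      (a + b - c) / (2 * c) := by field_simp; ring
  rw [e] at hprod
  calc 2 * r * (1 + 2 * r * R / D ^ 2 * (1 + √(1 - (D / (2 * R)) ^ 2)))
      ≤ 2 * r * (1 + (a + b - c) / (2 * c)) := by gcongr
    _ = r * (c + a + b) / c := by field_simp; ring
    _ ≤ S / c := by gcongr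

theorem upperBound_le_width_of_nonobtuse {A B C : Plane} (hS : doubleArea A B C ≠ 0)
    (hA : 0 ≤ inner ℝ (B - A) (C - A)) (hB : 0 ≤ inner ℝ (A - B) (C - B))
    (hC : 0 ≤ inner ℝ (A - C) (B - C)) (hBC : dist B C ≤ dist A B) (hCA : dist C A ≤ dist A B) :
    upperBound (convexHull ℝ {A, B, C}) ≤ width (convexHull ℝ {A, B, C}) := by
  have h1 : 0 < dist A B := dist_pos.2 fun h => hS (by rw [h]; simp only [doubleArea]; ring)
  have h2 : 0 < dist B C := dist_pos.2 fun h => hS (by rw [h]; simp only [doubleArea]; ring)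
  have h3 : 0 < dist C A := dist_pos.2 fun h => hS (by rw [h]; simp only [doubleArea]; ring)
  refine le_trans ?_ (abs_doubleArea_le_width_mul h1 le_rfl hBC hCA)
  have hsum : dist B C ^ 2 + dist C A ^ 2 - dist A B ^ 2 = 2 * inner ℝ (A - C) (B - C) := by
    rw [plane_dist_sq, plane_dist_sq, plane_dist_sq, plane_inner]
    simp only [PiLp.sub_apply]; ring
  refine upper_bound_le_altitude h2 h3 h1 (abs_pos.2 hS) (inradius_nonneg _)
    (inradius_le_of_triangle hS) (circumradius_eq_of_nonobtuse hS hA hB hC).1 ?_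
    (by rw [hsum]; linarith) ?_
  · exact Metric.dist_le_diam_of_mem (isCompact_convexHull_triple A B C).isBounded
      (subset_convexHull ℝ _ (by simp)) (subset_convexHull ℝ _ (by simp))
  · rw [hsum, sq_abs, plane_dist_sq, plane_dist_sq, plane_inner, doubleArea]
    simp only [PiLp.sub_apply]; ring

/-! ### Nonobtuse triangles and the main theorem -/

theorem inner_nonneg_of_angle_le {A B C : Plane}
    (h : EuclideanGeometry.angle A B C ≤ Real.pi / 2) : 0 ≤ inner ℝ (A - B) (C - B) := by
  rw [EuclideanGeometry.angle, vsub_eq_sub, vsub_eq_sub] at h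
  rw [← InnerProductGeometry.cos_angle_mul_norm_mul_norm]
  refine mul_nonneg (Real.cos_nonneg_of_mem_Icc ⟨?_, h⟩) (by positivity)
  linarith [InnerProductGeometry.angle_nonneg (A - B) (C - B), Real.pi_pos]

theorem collinear_of_doubleArea_eq_zero {A B C : Plane} (hne : A ≠ B)
    (h : doubleArea A B C = 0) : Collinear ℝ {A, B, C} := by
  refine (collinear_iff_of_mem (p₀ := A) (by simp)).2 ⟨B - A, ?_⟩
  have hpos : dist B A ^ 2 ≠ 0 := pow_ne_zero 2 (dist_ne_zero.2 hne.symm)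
  rw [plane_dist_sq] at hpos
  rw [doubleArea] at h
  rintro p (rfl | rfl | rfl)
  · exact ⟨0, by simp⟩
  · exact ⟨1, by simp⟩
  · refine ⟨((B 0 - A 0) * (p 0 - A 0) + (B 1 - A 1) * (p 1 - A 1)) /
      ((B 0 - A 0) ^ 2 + (B 1 - A 1) ^ 2), ?_⟩
    ext l
    fin_cases l
    · simp only [Fin.zero_eta, vadd_eq_add, PiLp.add_apply, PiLp.smul_apply, PiLp.sub_apply,
        smul_eq_mul]
      field_simp
      linear_combination -(B 1 - A 1) * h
    · simp only [Fin.mk_one, vadd_eq_add, PiLp.add_apply, PiLp.smul_apply, PiLp.sub_apply,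
        smul_eq_mul]
      field_simp
      linear_combination (B 0 - A 0) * h

theorem doubleArea_ne_zero_of_affineIndependent {t : Affine.Triangle ℝ Plane} {i j k : Fin 3}
    (hij : i ≠ j) (hik : i ≠ k) (hjk : j ≠ k) :
    doubleArea (t.points i) (t.points j) (t.points k) ≠ 0 := fun h =>
  (affineIndependent_iff_not_collinear_of_ne hij hik hjk).1 t.independent
    (collinear_of_doubleArea_eq_zero (fun h' => hij (t.independent.injective h')) h)

theorem exists_longest_side (t : Affine.Triangle ℝ Plane) :
    ∃ i j k : Fin 3, i ≠ j ∧ i ≠ k ∧ j ≠ k ∧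
      dist (t.points j) (t.points k) ≤ dist (t.points i) (t.points j) ∧
      dist (t.points k) (t.points i) ≤ dist (t.points i) (t.points j) := by
  rcases le_total (dist (t.points 0) (t.points 1)) (dist (t.points 1) (t.points 2)) with h1 | h1
  · rcases le_total (dist (t.points 1) (t.points 2)) (dist (t.points 2) (t.points 0)) with h2 | h2
    · exact ⟨2, 0, 1, by decide, by decide, by decide, h1.trans h2, h2⟩
    · exact ⟨1, 2, 0, by decide, by decide, by decide, h2, h1⟩
  · rcases le_total (dist (t.points 0) (t.points 1)) (dist (t.points 2) (t.points 0)) with h2 | h2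
    · exact ⟨2, 0, 1, by decide, by decide, by decide, h2, h1.trans h2⟩
    · exact ⟨0, 1, 2, by decide, by decide, by decide, h1, h2⟩

theorem mainTheorem3 :
    (∀ K : ConvexBody PlanarRadii.Plane, (K : Set PlanarRadii.Plane).Nontrivial →
      PlanarRadii.width K ≤ PlanarRadii.upperBound K) ∧
    (∀ t : Affine.Triangle ℝ PlanarRadii.Plane, PlanarRadii.NonObtuse t →
      PlanarRadii.Circumspherical t ∧
      PlanarRadii.width (PlanarRadii.triangleBody t) =
        PlanarRadii.upperBound (PlanarRadii.triangleBody t)) := by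
  refine ⟨width_le_upperBound, fun t ht => ?_⟩
  obtain ⟨i, j, k, hij, hik, hjk, h1, h2⟩ := exists_longest_side t
  have hS := doubleArea_ne_zero_of_affineIndependent (t := t) hij hik hjk
  have hA := inner_nonneg_of_angle_le (ht j i k hij.symm hjk hik)
  have hB := inner_nonneg_of_angle_le (ht i j k hij hik hjk)
  have hC := inner_nonneg_of_angle_le (ht i k j hik hij hjk.symm)
  have hmem : ∀ l, t.points l ∈ ({t.points i, t.points j, t.points k} : Set Plane) := by
    intro l
    have : l = i ∨ l = j ∨ l = k := by
      clear * - hij hik hjk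
      decide +revert
    rcases this with rfl | rfl | rfl <;> simp
  have hbody : triangleBody t = convexHull ℝ {t.points i, t.points j, t.points k} := by
    rw [triangleBody]
    congr 1
    refine Set.Subset.antisymm (Set.range_subset_iff.2 hmem) ?_
    rintro _ (rfl | rfl | rfl) <;> exact Set.mem_range_self _
  obtain ⟨-, o, ho, ho'⟩ := circumradius_eq_of_nonobtuse hS hA hB hC
  refine ⟨⟨o, by rw [hbody]; exact ho, fun l => by rw [hbody]; exact ho' _ (hmem l)⟩, ?_⟩
  rw [hbody]
  refine le_antisymm ?_ (upperBound_le_width_of_nonobtuse hS hA hB hC h1 h2)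
  refine width_le_upperBound ⟨_, convex_convexHull ℝ _, isCompact_convexHull_triple _ _ _,
    ⟨_, subset_convexHull ℝ _ (Set.mem_insert _ _)⟩⟩ ?_
  exact ⟨t.points i, subset_convexHull ℝ _ (hmem i), t.points j, subset_convexHull ℝ _ (hmem j),
    fun h => hij (t.independent.injective h)⟩
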